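/- **Setting.** Let $\mathcal V=\bigwedge^{\infty/2}V$, $V=\bigoplus_{i\in\mathbb Z+1/2}\mathbb C\,\underline i$, be the semi-infinite wedge space, spanned by the vectors $\underline{k_1}\wedge\underline{k_2}\wedge\cdots$ with $k_i+i-\frac12$ eventually constant, with the inner product for which the wedge products with $k_1>k_2>\cdots$ are orthonormal. Let $\psi_k$ be the operator $\underline k\wedge(\cdot)$, $\psi_k^\dagger$ its adjoint, $E_{i,j}=\psi_i\psi_j^\dagger$ for $j>0$ and $E_{i,j}=-\psi_j^\dagger\psi_i$ for $j<0$. Put $\varsigma(z)=e^{z/2}-e^{-z/2}$, $$\mathcal E_n(z)=\sum_{k\in\mathbb Z+\frac12}e^{z(k-\frac n2)}E_{k-n,k}\quad(n\ne0),\qquad \tilde{\mathcal E}_0(z)=\sum_{k\in\mathbb Z+\frac12}e^{zk}E_{k,k},\qquad \alpha_n=\sum_{k\in\mathbb Z+\frac12}E_{k-n,k},$$ and let $\langle P\rangle$ be the coefficient of the vacuum $\underline{-\frac12}\wedge\underline{-\frac32}\wedge\cdots$ in $P$ applied to the vacuum. For integers $k\ge0$, $r\ge-1$, $s\ge0$ and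 tuples of positive integers $\mu=(\mu_1,\dots,\mu_m)$, $\nu=(\nu_1,\dots,\nu_n)$, the disconnected $k$-leaky $(r+1)$-completed cycles Hurwitz numbers are $$h^{\wr,k,r+1,s}_{\mu,\nu}=[z_1^{r+1}\cdots z_s^{r+1}]\,\frac1{\prod_i\mu_i\prod_j\nu_j}\Big\langle\prod_{i=1}^m\alpha_{\mu_i}\prod_{t=1}^s\mathcal E_{-k}(z_t)\prod_{j=1}^n\alpha_{-\nu_j}\Big\rangle,$$ where $\mathcal E_{-k}$ is replaced by $\tilde{\mathcal E}_0$ if $k=0$. Their generating series is the formal power series in $\beta,p_1,p_2,\dots,q_1,q_2,\dots$ $$\mathcal H^{\wr,k,r+1}(\beta,\vec p,\vec q)=\sum_{s\ge0}\ \sum_{m,n\ge1}\ \sum_{\mu_1,\dots,\mu_m\ge1}\ \sum_{\nu_1,\dots,\nu_n\ge1}h^{\wr,k,r+1,s}_{\mu,\nu}\,\frac{\beta^s}{s!}\,\frac{p_{\mu_1}\cdots p_{\mu_m}}{m!}\,\frac{q_{\nu_1}\cdots q_{\nu_n}}{n!}.$$ The cut-and-join operator $Q^{\wr}_{k,r+1}$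 is the coefficient of $z^{r+1}$ in $$\frac1{\varsigma(z)}\sum_{\substack{m,n\ge0\\ m+n\ge1}}\frac1{m!\,n!}\sum_{\substack{k_1,\dots,k_m\ge1\\ \ell_1,\dots,\ell_n\ge1\\ k_1+\cdots+k_m=\ell_1+\cdots+\ell_n+k}}\ \prod_{i=1}^m\varsigma(k_iz)\frac{p_{k_i}}{k_i}\ \prod_{j=1}^n\varsigma(\ell_jz)\frac{\partial}{\partial p_{\ell_j}}.$$ **Theorem.** For all integers $k\ge0$ and $r\ge-1$, $$\frac{\partial}{\partial\beta}\mathcal H^{\wr,k,r+1}=Q^{\wr}_{k,r+1}\,\mathcal H^{\wr,k,r+1}.$$ -/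

import Mathlib

namespace LeakyHurwitz

/-! ### The semi-infinite wedge space

A half-integer `a + 1/2` is encoded by the integer `a`; so `a + 1/2 > 0` means `0 ≤ a` and
`a + 1/2 < 0` means `a < 0`. -/

/-- The basis vectors `k₁ ∧ k₂ ∧ k₃ ∧ ⋯` with `k₁ > k₂ > ⋯` and `k_i + i - 1/2` eventually constant,
recorded as the set `{k₁, k₂, …}`: a set of half-integers which contains finitely many positive
ones and all but finitely many of the negative ones. -/
def Maya : Type :=
  {S : Set ℤ // (S ∩ Set.Ici 0).Finite ∧ (Sᶜ ∩ Set.Iio 0).Finite}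

namespace Maya

/-- The vacuum `-1/2 ∧ -3/2 ∧ -5/2 ∧ ⋯`. -/
def vacuum : Maya := ⟨Set.Iio 0, by
  constructor
  · convert Set.finite_empty
    ext x; simp
  · convert Set.finite_empty
    ext x; simp⟩

/-- Add the factor `a + 1/2`. -/
def add (S : Maya) (a : ℤ) : Maya := ⟨insert a S.1, by
  constructor
  · refine (S.2.1.union (Set.finite_singleton a)).subset ?_
    rintro x ⟨h | h, hx⟩
    · exact Or.inr h
    · exact Or.inl ⟨h, hx⟩
  · refine S.2.2.subset ?_
    rintro x ⟨h, hx⟩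
    exact ⟨fun h' => h (Or.inr h'), hx⟩⟩

/-- Remove the factor `a + 1/2`. -/
def remove (S : Maya) (a : ℤ) : Maya := ⟨S.1 \ {a}, by
  constructor
  · refine S.2.1.subset ?_
    rintro x ⟨h, hx⟩
    exact ⟨h.1, hx⟩
  · refine (S.2.2.union (Set.finite_singleton a)).subset ?_
    rintro x ⟨h, hx⟩
    by_cases hxa : x = a
    · exact Or.inr hxa
    · exact Or.inl ⟨fun h' => h ⟨h', hxa⟩, hx⟩⟩

/-- The number of factors of the wedge product that are larger than `a + 1/2`. -/
noncomputable def above (S : Maya) (a : ℤ) : ℕ := (S.1 ∩ Set.Ioi a).ncard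

lemma above_finite (S : Maya) (a : ℤ) : (S.1 ∩ Set.Ioi a).Finite := by
  refine (S.2.1.union (Set.finite_Ioo a 0)).subset ?_
  rintro x ⟨h, hx⟩
  by_cases h0 : 0 ≤ x
  · exact Or.inl ⟨h, h0⟩
  · exact Or.inr ⟨hx, not_le.mp h0⟩

end Maya

/-- The semi-infinite wedge space (all charges), with the wedge products as a basis. -/
abbrev Fock : Type := Maya →₀ ℂ

open Classical in
/-- The operator `ψ_{a+1/2}`: wedge with `a + 1/2` from the left. -/
noncomputable def psi (a : ℤ) : Module.End ℂ Fock :=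
  Finsupp.linearCombination ℂ fun S : Maya =>
    if a ∈ S.1 then 0 else Finsupp.single (S.add a) ((-1 : ℂ) ^ S.above a)

open Classical in
/-- The adjoint operator `ψ†_{a+1/2}`, see `psi_adjoint`. -/
noncomputable def psiDag (a : ℤ) : Module.End ℂ Fock :=
  Finsupp.linearCombination ℂ fun S : Maya =>
    if a ∈ S.1 then Finsupp.single (S.remove a) ((-1 : ℂ) ^ S.above a) else 0

/-- `ψ` and `ψ†` are adjoint with respect to the inner product for which the wedge products form
an orthonormal basis. -/
lemma psi_adjoint (a : ℤ) (S T : Maya) :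
    psi a (Finsupp.single S 1) T = psiDag a (Finsupp.single T 1) S := by
  classical
  have key : (a ∉ S.1 ∧ S.add a = T) ↔ (a ∈ T.1 ∧ T.remove a = S) := by
    constructor
    · rintro ⟨h, rfl⟩
      refine ⟨Or.inl rfl, Subtype.ext ?_⟩
      ext x
      simp only [Maya.remove, Maya.add, Set.mem_sdiff, Set.mem_insert_iff, Set.mem_singleton_iff]
      constructor
      · rintro ⟨h1 | h1, h2⟩
        · exact absurd h1 h2
        · exact h1
      · intro hx
        exact ⟨Or.inr hx, fun hxa => h (hxa ▸ hx)⟩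
    · rintro ⟨h, rfl⟩
      refine ⟨fun h' => h'.2 rfl, Subtype.ext ?_⟩
      ext x
      simp only [Maya.remove, Maya.add, Set.mem_sdiff, Set.mem_insert_iff, Set.mem_singleton_iff]
      constructor
      · rintro (h1 | h1)
        · exact h1 ▸ h
        · exact h1.1
      · intro hx
        by_cases hxa : x = a
        · exact Or.inl hxa
        · exact Or.inr ⟨hx, hxa⟩
  simp only [psi, psiDag, Finsupp.linearCombination_single, one_smul]
  by_cases h : a ∉ S.1 ∧ S.add a = T
  · have h2 := key.1 h
    have hab : S.above a = T.above a := by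
      rw [← h.2]
      unfold Maya.above
      congr 1
      ext x
      simp only [Maya.add, Set.mem_inter_iff, Set.mem_insert_iff, Set.mem_Ioi]
      constructor
      · rintro ⟨h1, h3⟩; exact ⟨Or.inr h1, h3⟩
      · rintro ⟨h1 | h1, h3⟩
        · omega
        · exact ⟨h1, h3⟩
    rw [if_neg h.1, if_pos h2.1, h.2, h2.2, hab]
    simp
  · have h2 := fun h' => h (key.2 h')
    have e1 : (if a ∈ S.1 then (0 : Fock)
        else Finsupp.single (S.add a) ((-1 : ℂ) ^ S.above a)) T = 0 := by
      split_ifs with h3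
      · rfl
      · exact Finsupp.single_eq_of_ne fun h4 => h ⟨h3, h4.symm⟩
    have e2 : (if a ∈ T.1 then Finsupp.single (T.remove a) ((-1 : ℂ) ^ T.above a)
        else (0 : Fock)) S = 0 := by
      split_ifs with h3
      · exact Finsupp.single_eq_of_ne fun h4 => h2 ⟨h3, h4.symm⟩
      · rfl
    rw [e1, e2]

/-- The normally ordered product `E_{i+1/2, j+1/2}`. -/
noncomputable def normalE (i j : ℤ) : Module.End ℂ Fock :=
  if 0 ≤ j then psi i * psiDag j else -(psiDag j * psi i)

/-- On each basis vector only finitely many summands of `∑_k c_k E_{k-n,k}` are nonzero. -/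
lemma normalE_finite (n : ℤ) (S : Maya) :
    (Function.support fun a : ℤ => normalE (a - n) a (Finsupp.single S 1)).Finite := by
  classical
  have hfin : ((fun a : ℤ => a - n) ⁻¹' (S.1ᶜ ∩ Set.Iio 0)).Finite :=
    S.2.2.preimage (fun x _ y _ h => by simpa using h)
  refine ((S.2.1.union hfin).union (Set.finite_Ico n 0)).subset ?_
  intro a ha
  rw [Function.mem_support] at ha
  by_cases h0 : 0 ≤ a
  · refine Or.inl (Or.inl ⟨?_, h0⟩)
    by_contra hS
    apply ha
    simp [normalE, h0, psiDag, hS]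
  · by_cases h1 : a - n < 0
    · refine Or.inl (Or.inr ⟨?_, h1⟩)
      intro hS
      apply ha
      simp [normalE, h0, psi, hS]
    · exact Or.inr ⟨by omega, by omega⟩

/-- The operator-valued power series `∑_{k ∈ ℤ + 1/2} e^{z (k - n/2)} E_{k-n,k}`.
For `n ≠ 0` it is `𝓔_n(z)`, and for `n = 0` it is `𝓔̃_0(z)`, that is `𝓔_0(z)` without the
scalar correction `1/ς(z)`. -/
noncomputable def calE (n : ℤ) : PowerSeries (Module.End ℂ Fock) :=
  PowerSeries.mk fun d => Finsupp.linearCombination ℂ fun S : Maya =>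
    ∑ᶠ a : ℤ,
      PowerSeries.coeff d
          (PowerSeries.rescale ((a : ℂ) + 1 / 2 - (n : ℂ) / 2) (PowerSeries.exp ℂ)) •
        normalE (a - n) a (Finsupp.single S 1)

/-- The operators `α_n = 𝓔_n(0) = ∑_{k ∈ ℤ + 1/2} E_{k-n,k}`. -/
noncomputable def alpha (n : ℤ) : Module.End ℂ Fock :=
  PowerSeries.constantCoeff (calE n)

/-- The vacuum expectation value `⟨P⟩`. -/
noncomputable def vev (P : Module.End ℂ Fock) : ℂ :=
  P (Finsupp.single Maya.vacuum 1) Maya.vacuum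

/-! ### Leaky completed cycles Hurwitz numbers -/

/-- The formal power series in `z_1, …, z_s`
`⟨∏_i α_{μ_i} ∏_{p=1}^s 𝓔_{-k}(z_p) ∏_j α_{-ν_j}⟩` (with `𝓔̃_0` for `k = 0`). -/
noncomputable def correlator (k : ℤ) (s : ℕ) (μ ν : List ℕ+) : MvPowerSeries (Fin s) ℂ :=
  fun e => vev
    ((μ.map fun m : ℕ+ => alpha (m : ℤ)).prod *
      (List.ofFn fun t : Fin s => PowerSeries.coeff (e t) (calE (-k))).prod *
      (ν.map fun m : ℕ+ => alpha (-(m : ℤ))).prod)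

/-- The product `∏ μ_i` of the parts. -/
noncomputable def partProd (μ : List ℕ+) : ℂ := (μ.map fun m : ℕ+ => (m : ℂ)).prod

/-- The sum `∑ μ_i` of the parts. -/
def partSum (μ : List ℕ+) : ℕ := (μ.map fun m : ℕ+ => (m : ℕ)).sum

/-- The possibly disconnected `k`-leaky `d`-completed cycles Hurwitz number with `s` completed
cycles, `[z_1^d ⋯ z_s^d] (∏ μ_i ∏ ν_j)⁻¹ ⟨∏ α_{μ_i} ∏_p 𝓔_{-k}(z_p) ∏ α_{-ν_j}⟩`; here `d = r + 1`. -/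
noncomputable def hurwitz (k : ℤ) (d s : ℕ) (μ ν : List ℕ+) : ℂ :=
  (partProd μ * partProd ν)⁻¹ *
    MvPowerSeries.coeff (Finsupp.equivFunOnFinite.symm fun _ : Fin s => d) (correlator k s μ ν)

/-! ### Formal power series in `β, p_1, p_2, …, q_1, q_2, …` -/

/-- The variables. -/
inductive Var : Type
  | beta : Var
  | p : ℕ+ → Var
  | q : ℕ+ → Var

/-- The ring `ℂ[[β, p_1, p_2, …, q_1, q_2, …]]`. -/
abbrev Ser : Type := MvPowerSeries Var ℂ

/-- The sum of a family of power series in which every monomial occurs in only finitely many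
members. -/
noncomputable def formalSum {ι : Type} (f : ι → Ser) : Ser :=
  fun e => ∑ᶠ i, MvPowerSeries.coeff e (f i)

/-- The summand of the generating series that belongs to `s` and to the tuples
`μ = (μ_1, …, μ_m)`, `ν = (ν_1, …, ν_n)`. -/
noncomputable def genTerm (k : ℤ) (d s : ℕ) (μ ν : List ℕ+) : Ser :=
  (hurwitz k d s μ ν / ((s.factorial : ℂ) * μ.length.factorial * ν.length.factorial)) •
    (MvPowerSeries.X Var.beta ^ s *
      (μ.map fun i : ℕ+ => (MvPowerSeries.X (Var.p i) : Ser)).prod *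
      (ν.map fun i : ℕ+ => (MvPowerSeries.X (Var.q i) : Ser)).prod)

/-- The generating series of the disconnected leaky Hurwitz numbers: the sum over `s ≥ 0`,
`m, n ≥ 1`, `μ ∈ ℕ_{>0}^m` and `ν ∈ ℕ_{>0}^n`. -/
noncomputable def genSeries (k : ℤ) (d : ℕ) : Ser :=
  formalSum fun x : ℕ × {μ : List ℕ+ // μ ≠ []} × {ν : List ℕ+ // ν ≠ []} =>
    genTerm k d x.1 x.2.1 x.2.2

/-! ### The cut-and-join operator -/

/-- The power series `ς(z) = e^{z/2} - e^{-z/2}`. -/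
noncomputable def sinhSer : PowerSeries ℂ :=
  PowerSeries.rescale (1 / 2 : ℂ) (PowerSeries.exp ℂ) -
    PowerSeries.rescale (-(1 / 2) : ℂ) (PowerSeries.exp ℂ)

/-- `[z^d] ς(z)⁻¹ ∏_i ς(κ_i z) ∏_j ς(ℓ_j z)`, taken in Laurent series. -/
noncomputable def sinhCoeff (d : ℕ) (κ l : List ℕ+) : ℂ :=
  ((sinhSer : LaurentSeries ℂ)⁻¹ *
    (κ.map fun a : ℕ+ => ((PowerSeries.rescale (a : ℂ) sinhSer : PowerSeries ℂ) :
      LaurentSeries ℂ)).prod *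
    (l.map fun b : ℕ+ => ((PowerSeries.rescale (b : ℂ) sinhSer : PowerSeries ℂ) :
      LaurentSeries ℂ)).prod).coeff (d : ℤ)

/-- `(1 / (m! n!)) [z^d] ( ς(z)⁻¹ ∏_{i=1}^m ς(κ_i z) p_{κ_i}/κ_i ∏_{j=1}^n ς(ℓ_j z) ∂/∂p_{ℓ_j} )`
applied to `F`. -/
noncomputable def cutJoinTerm (d : ℕ) (κ l : List ℕ+) (F : Ser) : Ser :=
  (sinhCoeff d κ l / ((κ.length.factorial : ℂ) * l.length.factorial * partProd κ)) •
    ((κ.map fun a : ℕ+ => (MvPowerSeries.X (Var.p a) : Ser)).prod *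
      (l.map fun b : ℕ+ => ((MvPowerSeries.pderiv ℂ (Var.p b) : Derivation ℂ Ser Ser) :
        Module.End ℂ Ser)).prod F)

/-- The `k`-leaky `d`-completed cycles cut-and-join operator `Q_{k,d}`, `d = r + 1`: the sum of the
`cutJoinTerm`s over all pairs of tuples `(κ, ℓ)`, not both empty, with `∑ κ_i = ∑ ℓ_j + k`. -/
noncomputable def cutJoin (k d : ℕ) (F : Ser) : Ser :=
  formalSum fun x : {x : List ℕ+ × List ℕ+ //
      ¬(x.1 = [] ∧ x.2 = []) ∧ partSum x.1 = partSum x.2 + k} =>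
    cutJoinTerm d x.1.1 x.1.2 F

/-! ### The two formal sums are locally finite -/

lemma finite_partSum_le (B : ℕ) : {l : List ℕ+ | partSum l ≤ B}.Finite := by
  have h1 : ∀ l : List ℕ+, l.length ≤ partSum l := by
    intro l
    induction l with
    | nil => simp [partSum]
    | cons a l ih =>
      have := a.pos
      simp only [partSum, List.length_cons, List.map_cons, List.sum_cons] at ih ⊢
      omega
  have h2 : ∀ l : List ℕ+, ∀ a ∈ l, (a : ℕ) ≤ partSum l := by
    intro l a ha
    exact List.single_le_sum (fun _ _ => Nat.zero_le _) _ (List.mem_map_of_mem ha)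
  have hA : {a : ℕ+ | (a : ℕ) ≤ B}.Finite :=
    (Set.finite_Iic B).preimage (f := fun a : ℕ+ => (a : ℕ)) PNat.coe_injective.injOn
  have : Finite {a : ℕ+ // (a : ℕ) ≤ B} := hA
  have h3 := (List.finite_length_le {a : ℕ+ // (a : ℕ) ≤ B} B).image
    (fun l => l.map Subtype.val)
  refine h3.subset ?_
  intro l hl
  refine ⟨l.attach.map fun a => ⟨a.1, (h2 l a.1 a.2).trans hl⟩, ?_, ?_⟩
  · simpa using (h1 l).trans hl
  · simp [List.map_map, Function.comp_def]

/-- The exponent of the monomial `∏ v(κ_i)`. -/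
noncomputable def expo (v : ℕ+ → Var) (κ : List ℕ+) : Var →₀ ℕ :=
  (κ.map fun a : ℕ+ => Finsupp.single (v a) 1).sum

lemma prod_X_eq (v : ℕ+ → Var) (κ : List ℕ+) :
    (κ.map fun a : ℕ+ => (MvPowerSeries.X (v a) : Ser)).prod =
      MvPowerSeries.monomial (expo v κ) 1 := by
  induction κ with
  | nil => rfl
  | cons a κ ih =>
    simp only [List.map_cons, List.prod_cons, ih, expo, List.sum_cons]
    rw [MvPowerSeries.X, MvPowerSeries.monomial_mul_monomial, one_mul]

/-- The weighted degree in which `p_i` and `q_i` have degree `i`. -/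
def Var.weight : Var → ℕ
  | Var.beta => 1
  | Var.p i => i
  | Var.q i => i

lemma weight_expo (v : ℕ+ → Var) (hv : ∀ i, (v i).weight = i) (κ : List ℕ+) :
    Finsupp.weight Var.weight (expo v κ) = partSum κ := by
  simp only [expo, partSum, map_list_sum, List.map_map]
  congr 1
  apply List.map_congr_left
  intro a _
  simp [Finsupp.weight_single, hv]

lemma weight_mono {e e' : Var →₀ ℕ} (h : e ≤ e') :
    Finsupp.weight Var.weight e ≤ Finsupp.weight Var.weight e' := by
  obtain ⟨c, rfl⟩ := exists_add_of_le h
  simp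

lemma cutJoin_finite (k d : ℕ) (F : Ser) (e : Var →₀ ℕ) :
    (Function.support fun x : {x : List ℕ+ × List ℕ+ //
        ¬(x.1 = [] ∧ x.2 = []) ∧ partSum x.1 = partSum x.2 + k} =>
      MvPowerSeries.coeff e (cutJoinTerm d x.1.1 x.1.2 F)).Finite := by
  classical
  have hB := finite_partSum_le (Finsupp.weight Var.weight e)
  refine Set.Finite.subset ((hB.prod hB).preimage
    (f := fun x : {x : List ℕ+ × List ℕ+ //
        ¬(x.1 = [] ∧ x.2 = []) ∧ partSum x.1 = partSum x.2 + k} => x.1)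
    Subtype.val_injective.injOn) ?_
  rintro ⟨⟨κ, l⟩, h0, hs⟩ hx
  simp only at h0 hs
  have hle : expo Var.p κ ≤ e := by
    by_contra hn
    apply hx
    simp only [cutJoinTerm, prod_X_eq, MvPowerSeries.coeff_smul,
      MvPowerSeries.coeff_monomial_mul, if_neg hn, mul_zero]
  have h1 := weight_mono hle
  rw [weight_expo _ fun _ => rfl] at h1
  exact ⟨h1, show partSum l ≤ _ by omega⟩

lemma genSeries_finite (k : ℤ) (d : ℕ) (e : Var →₀ ℕ) :
    (Function.support fun x : ℕ × {μ : List ℕ+ // μ ≠ []} × {ν : List ℕ+ // ν ≠ []} =>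
      MvPowerSeries.coeff e (genTerm k d x.1 x.2.1 x.2.2)).Finite := by
  classical
  have hB := finite_partSum_le (Finsupp.weight Var.weight e)
  refine Set.Finite.subset (((Set.finite_Iic (Finsupp.weight Var.weight e)).prod
    (hB.prod hB)).preimage
    (f := fun x : ℕ × {μ : List ℕ+ // μ ≠ []} × {ν : List ℕ+ // ν ≠ []} =>
      (x.1, x.2.1.1, x.2.2.1)) ?_) ?_
  · rintro ⟨s, ⟨μ, hμ⟩, ⟨ν, hν⟩⟩ _ ⟨s', ⟨μ', hμ'⟩, ⟨ν', hν'⟩⟩ _ h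
    simp only [Prod.mk.injEq] at h
    obtain ⟨rfl, rfl, rfl⟩ := h
    rfl
  · rintro ⟨s, ⟨μ, hμ⟩, ⟨ν, hν⟩⟩ hx
    have he : e = Finsupp.single Var.beta s + expo Var.p μ + expo Var.q ν := by
      by_contra hn
      apply hx
      simp only [genTerm, prod_X_eq, MvPowerSeries.coeff_smul, MvPowerSeries.X_pow_eq,
        MvPowerSeries.monomial_mul_monomial, MvPowerSeries.coeff_monomial, if_neg hn, mul_zero]
    have hw : Finsupp.weight Var.weight e = s + partSum μ + partSum ν := by
      rw [he, map_add, map_add, weight_expo _ fun _ => rfl, weight_expo _ fun _ => rfl]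
      simp [Finsupp.weight_single, Var.weight]
    refine ⟨?_, ?_, ?_⟩
    · show s ≤ _
      omega
    · show partSum μ ≤ _
      omega
    · show partSum ν ≤ _
      omega

end LeakyHurwitz

namespace LeakyHurwitz

/-! ### Canonical anticommutation relations -/

namespace Maya

/-! Both sides are compared at each monomial β^s p_M q_N, with M and N multisets. For N nonempty,
the coefficient of the generating series is (|Aut M| ∏M)⁻¹ times the value of ⟨0|α_M on a vector w_s
(`stateVec`) that contains s copies of 𝓔 = [z^d] 𝓔_{-k}(z). As 𝓔 w_s = (s+1) w_{s+1},
differentiating in β inserts one more 𝓔 next to the α's. It remains to write the covector ⟨0|α_M 𝓔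
as a combination of covectors ⟨0|α_{M-I+L} (`vacAlpha_calE`): removing I corresponds to
multiplication by p_I, adding L to differentiation in the p_ℓ with ℓ in L.

Two facts give this. First, [α_m, 𝓔_n(z)] = ς(mz) 𝓔_{n+m}(z), provided that 𝓔_0 carries its scalar
1/ς(z) (`matEC_comp_alpha`). Moving α_M to the right of 𝓔_{-k}(z) absorbs a part I of M and produces
∏ ς(κ_i z). Second, ⟨0|𝓔_N(z) = ς(z)⁻¹ ∑_{|L|=N} |Aut L|⁻¹ ∏_{ℓ∈L} (ς(ℓz)/ℓ) ⟨0|α_L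
(`matEC_vac_eq_sum`).

The second fact follows by induction from N ⟨0|𝓔_N = ∑_{l=1}^N ς(lz) ⟨0|𝓔_{N-l} α_l
(`matEC_vac_recursion`). Here ⟨0|𝓔_N is a finite sum of hook covectors ⟨0|ψ_{-1-b} ψ†_a with a + b +
1 = N, and the recursion is a finite identity (`hook_recursion`): four-fermion terms cancel by
antisymmetry, and the two-fermion terms add up to N times each hook.

All identities are between matrix elements in the field ℂ((z)), where ς(z) is invertible. -/

lemma mem_add {S : Maya} {a x : ℤ} : x ∈ (S.add a).1 ↔ x = a ∨ x ∈ S.1 := Iff.rfl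

lemma mem_remove {S : Maya} {a x : ℤ} : x ∈ (S.remove a).1 ↔ x ∈ S.1 ∧ x ≠ a := Iff.rfl

lemma ext_mem {S T : Maya} (h : ∀ x, x ∈ S.1 ↔ x ∈ T.1) : S = T := Subtype.ext (Set.ext h)

lemma add_comm (S : Maya) (a b : ℤ) : (S.add a).add b = (S.add b).add a :=
  ext_mem fun x => by simp only [mem_add]; tauto

lemma remove_comm (S : Maya) (a b : ℤ) : (S.remove a).remove b = (S.remove b).remove a :=
  ext_mem fun x => by simp only [mem_remove]; tauto

lemma add_remove_comm (S : Maya) {a b : ℤ} (h : a ≠ b) :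
    (S.add a).remove b = (S.remove b).add a :=
  ext_mem fun x => by
    simp only [mem_remove, mem_add]
    constructor
    · tauto
    · rintro (rfl | h1)
      · exact ⟨Or.inl rfl, h⟩
      · tauto

lemma add_remove_self {S : Maya} {a : ℤ} (h : a ∉ S.1) : (S.add a).remove a = S :=
  ext_mem fun x => by
    simp only [mem_remove, mem_add]
    constructor
    · tauto
    · intro hx
      exact ⟨Or.inr hx, fun e => h (e ▸ hx)⟩

lemma remove_add_self {S : Maya} {a : ℤ} (h : a ∈ S.1) : (S.remove a).add a = S :=
  ext_mem fun x => by
    simp only [mem_remove, mem_add]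
    constructor
    · rintro (rfl | h1)
      · exact h
      · exact h1.1
    · intro hx
      by_cases e : x = a
      · exact Or.inl e
      · exact Or.inr ⟨hx, e⟩

lemma above_add {S : Maya} {b : ℤ} (h : b ∉ S.1) (a : ℤ) :
    (S.add b).above a = S.above a + if a < b then 1 else 0 := by
  unfold above
  split_ifs with hab
  · rw [← Set.ncard_insert_of_notMem (fun h' => h h'.1) (S.above_finite a)]
    congr 1
    ext x
    simp only [Set.mem_inter_iff, mem_add, Set.mem_Ioi, Set.mem_insert_iff]
    constructor
    · tauto
    · rintro (rfl | h1)
      · exact ⟨Or.inl rfl, hab⟩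
      · tauto
  · rw [Nat.add_zero]
    congr 1
    ext x
    simp only [Set.mem_inter_iff, mem_add, Set.mem_Ioi]
    constructor
    · rintro ⟨rfl | h1, h2⟩
      · exact absurd h2 hab
      · exact ⟨h1, h2⟩
    · tauto

lemma above_remove {S : Maya} {b : ℤ} (h : b ∈ S.1) (a : ℤ) :
    S.above a = (S.remove b).above a + if a < b then 1 else 0 := by
  conv_lhs => rw [← remove_add_self h]
  exact above_add (fun h' => (mem_remove.1 h').2 rfl) a

end Maya

open Classical in
lemma psi_single (a : ℤ) (S : Maya) (c : ℂ) : psi a (Finsupp.single S c) =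
    if a ∈ S.1 then 0 else Finsupp.single (S.add a) (c * (-1 : ℂ) ^ S.above a) := by
  simp only [psi, Finsupp.linearCombination_single]
  split_ifs <;> simp

open Classical in
lemma psiDag_single (a : ℤ) (S : Maya) (c : ℂ) : psiDag a (Finsupp.single S c) =
    if a ∈ S.1 then Finsupp.single (S.remove a) (c * (-1 : ℂ) ^ S.above a) else 0 := by
  simp only [psiDag, Finsupp.linearCombination_single]
  split_ifs <;> simp

lemma end_ext {P Q : Module.End ℂ Fock}
    (h : ∀ S : Maya, P (Finsupp.single S 1) = Q (Finsupp.single S 1)) : P = Q :=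
  Finsupp.lhom_ext' fun S => LinearMap.ext_ring (h S)

/-- Source of the minus sign in the anticommutation relations: for distinct positions, exactly one
of the two factors has to pass the other. -/
lemma neg_one_pow_ite_add (P Q : Prop) [Decidable P] [Decidable Q] (h : P ↔ ¬Q) :
    (-1 : ℂ) ^ (if P then 1 else 0) = -(-1 : ℂ) ^ (if Q then 1 else 0) := by
  by_cases hQ : Q <;> simp [h, hQ]

lemma neg_one_pow_sq (n : ℕ) : ((-1 : ℂ) ^ n) * (-1) ^ n = 1 := by
  rw [← mul_pow]; simp

lemma psi_mul_psi (a b : ℤ) : psi a * psi b = -(psi b * psi a) := by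
  classical
  refine end_ext fun S => ?_
  rw [LinearMap.neg_apply, Module.End.mul_apply, Module.End.mul_apply, psi_single, psi_single]
  by_cases hab : a = b
  · subst hab
    by_cases ha : a ∈ S.1
    · simp [ha]
    · simp [ha, psi_single, Maya.mem_add]
  by_cases ha : a ∈ S.1 <;> by_cases hb : b ∈ S.1
  · simp [ha, hb]
  · simp [ha, hb, psi_single, Maya.mem_add]
  · simp [ha, hb, psi_single, Maya.mem_add]
  · simp only [ha, hb, if_false, psi_single, Maya.mem_add, hab, Ne.symm hab, or_self,
      Maya.add_comm S b a, Maya.above_add hb, Maya.above_add ha, ← Finsupp.single_neg, one_mul,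
      pow_add, neg_one_pow_ite_add (a < b) (b < a) (by omega)]
    congr 1
    ring

lemma psiDag_mul_psiDag (a b : ℤ) : psiDag a * psiDag b = -(psiDag b * psiDag a) := by
  classical
  refine end_ext fun S => ?_
  rw [LinearMap.neg_apply, Module.End.mul_apply, Module.End.mul_apply, psiDag_single,
    psiDag_single]
  by_cases hab : a = b
  · subst hab
    by_cases ha : a ∈ S.1
    · simp [ha, psiDag_single, Maya.mem_remove]
    · simp [ha]
  by_cases ha : a ∈ S.1 <;> by_cases hb : b ∈ S.1
  · simp only [ha, hb, if_true, psiDag_single, Maya.mem_remove, ne_eq, hab, Ne.symm hab,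
      not_false_eq_true, and_self, Maya.remove_comm S b a, ← Finsupp.single_neg, one_mul]
    congr 1
    rw [Maya.above_remove hb a, Maya.above_remove ha b, pow_add, pow_add,
      neg_one_pow_ite_add (a < b) (b < a) (by omega)]
    ring
  · simp [ha, hb, psiDag_single, Maya.mem_remove]
  · simp [ha, hb, psiDag_single, Maya.mem_remove]
  · simp [ha, hb]

lemma psiDag_mul_psi (a b : ℤ) :
    psiDag a * psi b = (if a = b then 1 else 0) - psi b * psiDag a := by
  classical
  refine end_ext fun S => ?_
  rw [LinearMap.sub_apply, Module.End.mul_apply, Module.End.mul_apply, psi_single, psiDag_single]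
  by_cases hab : a = b
  · subst hab
    by_cases ha : a ∈ S.1
    · have := Maya.above_remove ha a
      rw [if_neg (lt_irrefl a), Nat.add_zero] at this
      simp [ha, psi_single, Maya.mem_remove, Maya.remove_add_self ha, ← this, ← mul_pow]
    · have := Maya.above_add ha a
      rw [if_neg (lt_irrefl a), Nat.add_zero] at this
      simp [ha, psiDag_single, Maya.mem_add, Maya.add_remove_self ha, this, ← mul_pow]
  rw [if_neg hab, LinearMap.zero_apply, zero_sub]
  by_cases ha : a ∈ S.1 <;> by_cases hb : b ∈ S.1
  · simp [ha, hb, psi_single, Maya.mem_remove, Ne.symm hab]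
  · simp only [ha, hb, if_true, if_false, psi_single, psiDag_single, Maya.mem_remove, ne_eq, hab,
      Ne.symm hab, not_false_eq_true, and_true, Maya.mem_add, or_true,
      Maya.add_remove_comm S (Ne.symm hab), ← Finsupp.single_neg, one_mul]
    congr 1
    rw [Maya.above_add hb a, Maya.above_remove ha b, pow_add, pow_add,
      neg_one_pow_ite_add (a < b) (b < a) (by omega)]
    -- The two signs enter with opposite placement here, so they agree only up to the square of a
    -- sign.
    linear_combination -(-1 : ℂ) ^ (S.remove a).above b * (-1) ^ S.above a *
      neg_one_pow_sq (if b < a then 1 else 0)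
  · simp [ha, hb]
  · simp [ha, hb, psiDag_single, Maya.mem_add, hab]

lemma psi_psi (a b : ℤ) (v : Fock) : psi a (psi b v) = -psi b (psi a v) :=
  LinearMap.congr_fun (psi_mul_psi a b) v

lemma psiDag_psiDag (a b : ℤ) (v : Fock) : psiDag a (psiDag b v) = -psiDag b (psiDag a v) :=
  LinearMap.congr_fun (psiDag_mul_psiDag a b) v

lemma psiDag_psi (a b : ℤ) (v : Fock) :
    psiDag a (psi b v) = (if a = b then v else 0) - psi b (psiDag a v) := by
  have := LinearMap.congr_fun (psiDag_mul_psi a b) v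
  rw [LinearMap.sub_apply] at this
  simp only [Module.End.mul_apply] at this
  rw [this]
  split_ifs <;> rfl

/-- Normal ordering changes ψψ† only by a constant on the diagonal. Commutators can thus be computed
for ψψ†, with the constants tracked separately. -/
lemma normalE_apply (i j : ℤ) (v : Fock) :
    normalE i j v = psi i (psiDag j v) - if i = j ∧ j < 0 then v else 0 := by
  unfold normalE
  by_cases hj : 0 ≤ j
  · rw [if_pos hj, if_neg (by omega), sub_zero]
    rfl
  · rw [if_neg hj, LinearMap.neg_apply, Module.End.mul_apply, psiDag_psi, neg_sub]
    by_cases hij : i = j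
    · rw [if_pos hij.symm, if_pos ⟨hij, by omega⟩]
    · rw [if_neg (Ne.symm hij), if_neg (by tauto)]

lemma normalE_psi (i j a : ℤ) (v : Fock) :
    normalE i j (psi a v) = psi a (normalE i j v) + if j = a then psi i v else 0 := by
  rw [normalE_apply, normalE_apply, psiDag_psi, map_sub, map_sub, psi_psi i a (psiDag j v)]
  split_ifs <;> (try simp only [map_zero]) <;> abel

lemma normalE_psiDag (i j a : ℤ) (v : Fock) :
    normalE i j (psiDag a v) = psiDag a (normalE i j v) - if i = a then psiDag j v else 0 := by
  rw [normalE_apply, normalE_apply, psiDag_psiDag, map_neg, map_sub, psiDag_psi a i]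
  by_cases hia : i = a
  · subst hia
    split_ifs <;> (try simp only [map_zero]) <;> abel
  · rw [if_neg (Ne.symm hia), if_neg hia, zero_sub]
    split_ifs <;> (try simp only [map_zero]) <;> abel

/-! ### The vacuum covector -/

lemma covector_ext {f g : Module.Dual ℂ Fock}
    (h : ∀ S : Maya, f (Finsupp.single S 1) = g (Finsupp.single S 1)) : f = g :=
  Finsupp.lhom_ext' fun S => LinearMap.ext_ring (h S)

/-- The covector `⟨0|`. -/
noncomputable def vac : Module.Dual ℂ Fock := Finsupp.lapply Maya.vacuum

lemma vac_psi {a : ℤ} (ha : 0 ≤ a) (v : Fock) : vac (psi a v) = 0 := by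
  have : vac ∘ₗ psi a = 0 := by
    refine covector_ext fun S => ?_
    have h : a ∉ Maya.vacuum.1 := fun h => absurd (show a < 0 from h) (by omega)
    change psi a (Finsupp.single S 1) Maya.vacuum = 0
    rw [psi_adjoint, psiDag_single, if_neg h]
    rfl
  exact LinearMap.congr_fun this v

lemma vac_psiDag {a : ℤ} (ha : a < 0) (v : Fock) : vac (psiDag a v) = 0 := by
  have : vac ∘ₗ psiDag a = 0 := by
    refine covector_ext fun S => ?_
    have h : a ∈ Maya.vacuum.1 := ha
    change psiDag a (Finsupp.single S 1) Maya.vacuum = 0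
    rw [← psi_adjoint, psi_single, if_pos h]
    rfl
  exact LinearMap.congr_fun this v

/-! ### Exponentials in the field of Laurent series -/

/-- The field `ℂ((z))`. -/
abbrev Lau : Type := LaurentSeries ℂ

/-- The series `e^{xz}`. -/
noncomputable def expL (x : ℂ) : Lau :=
  ((PowerSeries.rescale x (PowerSeries.exp ℂ) : PowerSeries ℂ) : LaurentSeries ℂ)

/-- The series `ς(xz)`. -/
noncomputable def sinhL (x : ℂ) : Lau := expL (x / 2) - expL (-(x / 2))

lemma expL_add (x y : ℂ) : expL (x + y) = expL x * expL y := by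
  unfold expL
  rw [← PowerSeries.exp_mul_exp_eq_exp_add, PowerSeries.coe_mul]

lemma coeff_expL (x : ℂ) (d : ℕ) : (expL x).coeff (d : ℤ) =
    PowerSeries.coeff d (PowerSeries.rescale x (PowerSeries.exp ℂ)) := by
  unfold expL
  exact LaurentSeries.coeff_coe_powerSeries _ _

lemma coe_rescale_sinhSer (x : ℂ) :
    ((PowerSeries.rescale x sinhSer : PowerSeries ℂ) : LaurentSeries ℂ) = sinhL x := by
  unfold sinhL expL sinhSer
  rw [map_sub, PowerSeries.rescale_rescale, PowerSeries.rescale_rescale, PowerSeries.coe_sub]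
  congr 4 <;> ring_nf

lemma coe_sinhSer : (sinhSer : LaurentSeries ℂ) = sinhL 1 := by
  rw [← coe_rescale_sinhSer, PowerSeries.rescale_one]
  rfl

/-- The coefficient of z in ς(z) is 1. -/
lemma sinhL_one_ne_zero : sinhL 1 ≠ 0 := by
  intro h
  have h1 := congrArg (fun x : Lau => x.coeff ((1 : ℕ) : ℤ)) h
  simp only [sinhL, HahnSeries.coeff_sub, coeff_expL, PowerSeries.coeff_rescale,
    PowerSeries.coeff_exp] at h1
  norm_num at h1

/-- Telescoping sum: this expands ς(mz)/ς(z) into m exponentials centred at 0. -/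
lemma sinhL_one_mul_sum (m : ℕ) :
    sinhL 1 * ∑ i ∈ Finset.range m, expL (i + 1 / 2 - m / 2) = sinhL m := by
  have h : ∀ i : ℕ, sinhL 1 * expL (i + 1 / 2 - m / 2) =
      expL ((i + 1 : ℕ) - m / 2) - expL ((i : ℕ) - m / 2) := by
    intro i
    rw [sinhL, sub_mul, ← expL_add, ← expL_add]
    congr 2 <;> push_cast <;> ring
  rw [Finset.mul_sum, Finset.sum_congr rfl fun i _ => h i,
    Finset.sum_range_sub (fun i : ℕ => expL ((i : ℂ) - m / 2)), sinhL]
  congr 2 <;> push_cast <;> ring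

/-! ### Operators `𝓔_n(z)` acting on vectors -/

lemma normalE_support_finite (n : ℤ) (v : Fock) :
    (Function.support fun a : ℤ => normalE (a - n) a v).Finite := by
  induction v using Finsupp.induction_linear with
  | zero => simp
  | add f g hf hg =>
    refine (hf.union hg).subset ?_
    simp only [map_add]
    exact Function.support_add _ _
  | single S c =>
    refine (normalE_finite n S).subset fun a ha h => ha ?_
    have : Finsupp.single S c = c • Finsupp.single S (1 : ℂ) := by simp
    simp only at h ⊢
    rw [this, map_smul, h, smul_zero]

lemma normalE_family_finite {A : Type*} [Zero A] (n : ℤ) (v : Fock) (g : ℤ → Fock → A)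
    (hg : ∀ a, g a 0 = 0) : (Function.support fun a : ℤ => g a (normalE (a - n) a v)).Finite := by
  refine (normalE_support_finite n v).subset fun a ha h => ha ?_
  simp only at h ⊢
  rw [h, hg]

lemma coeff_calE_apply (n : ℤ) (d : ℕ) (v : Fock) : PowerSeries.coeff d (calE n) v =
    ∑ᶠ a : ℤ, PowerSeries.coeff d
      (PowerSeries.rescale ((a : ℂ) + 1 / 2 - (n : ℂ) / 2) (PowerSeries.exp ℂ)) •
        normalE (a - n) a v := by
  induction v using Finsupp.induction_linear with
  | zero => simp
  | add f g hf hg =>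
    rw [map_add, hf, hg, ← finsum_add_distrib]
    · simp only [map_add, smul_add]
    · exact normalE_family_finite n f (fun a w => _ • w) fun a => smul_zero _
    · exact normalE_family_finite n g (fun a w => _ • w) fun a => smul_zero _
  | single S c =>
    have : Finsupp.single S c = c • Finsupp.single S (1 : ℂ) := by simp
    rw [this, map_smul, calE, PowerSeries.coeff_mk, Finsupp.linearCombination_single, one_smul,
      smul_finsum' c (normalE_family_finite n _ (fun a w => _ • w) fun a => smul_zero _)]
    refine finsum_congr fun a => ?_
    rw [map_smul, smul_comm]

lemma alpha_apply (n : ℤ) (v : Fock) : alpha n v = ∑ᶠ a : ℤ, normalE (a - n) a v := by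
  rw [alpha, ← PowerSeries.coeff_zero_eq_constantCoeff_apply, coeff_calE_apply]
  refine finsum_congr fun a => ?_
  simp [PowerSeries.coeff_rescale, PowerSeries.coeff_exp]

lemma map_alpha {A : Type*} [AddCommMonoid A] (f : Fock →+ A) (n : ℤ) (v : Fock) :
    f (alpha n v) = ∑ᶠ a : ℤ, f (normalE (a - n) a v) := by
  rw [alpha_apply]
  exact f.map_finsum (normalE_support_finite n v)

lemma alpha_psi (m a : ℤ) (v : Fock) :
    alpha m (psi a v) = psi a (alpha m v) + psi (a - m) v := by
  rw [alpha_apply, finsum_congr fun c => normalE_psi (c - m) c a v, finsum_add_distrib]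
  · congr 1
    · exact (map_alpha (psi a).toAddMonoidHom m v).symm
    · rw [finsum_eq_single _ a fun c hc => if_neg hc, if_pos rfl]
  · exact normalE_family_finite m v (fun _ w => psi a w) fun _ => map_zero _
  · refine (Set.finite_singleton a).subset fun c hc => ?_
    by_contra h
    exact hc (if_neg h)

lemma alpha_psiDag (m a : ℤ) (v : Fock) :
    alpha m (psiDag a v) = psiDag a (alpha m v) - psiDag (a + m) v := by
  rw [alpha_apply, finsum_congr fun c => normalE_psiDag (c - m) c a v, finsum_sub_distrib]
  · congr 1
    · exact (map_alpha (psiDag a).toAddMonoidHom m v).symm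
    · rw [finsum_eq_single _ (a + m) fun c hc => if_neg (by omega), if_pos (by omega)]
  · exact normalE_family_finite m v (fun _ w => psiDag a w) fun _ => map_zero _
  · refine (Set.finite_singleton (a + m)).subset fun c hc => ?_
    by_contra h
    exact hc (if_neg fun h' => h (show c = a + m by omega))

/-- The bare products ψψ† give the two shifted terms. The normal-ordering constants contribute only
when n + m = 0; this is the central term of the Heisenberg algebra. -/
lemma alpha_normalE (m n a : ℤ) (v : Fock) :
    alpha m (normalE (a - n) a v) = normalE (a - n) a (alpha m v) +
      normalE (a - (n + m)) a v - normalE (a - n) (a + m) v +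
      if n + m = 0 then (if a < 0 then v else 0) - (if a + m < 0 then v else 0) else 0 := by
  have e : a - n - m = a - (n + m) := by ring
  rw [normalE_apply, normalE_apply, normalE_apply, normalE_apply, map_sub, alpha_psi,
    alpha_psiDag, map_sub, e]
  have h1 : (if a - (n + m) = a ∧ a < 0 then v else 0) =
      if n + m = 0 then (if a < 0 then v else 0) else 0 := by
    split_ifs <;> first | rfl | omega
  have h2 : (if a - n = a + m ∧ a + m < 0 then v else 0) =
      if n + m = 0 then (if a + m < 0 then v else 0) else 0 := by
    split_ifs <;> first | rfl | omega
  have h3 : alpha m (if a - n = a ∧ a < 0 then v else 0) =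
      if a - n = a ∧ a < 0 then alpha m v else 0 := by
    split_ifs
    · rfl
    · exact map_zero _
  rw [h1, h2, h3]
  by_cases h : n + m = 0
  · simp only [if_pos h]; abel
  · simp only [if_neg h]; abel

lemma finsum_shift {A : Type*} [AddCommMonoid A] (g : ℤ → A) (m : ℤ) :
    ∑ᶠ a, g (a + m) = ∑ᶠ a, g a :=
  finsum_comp_equiv (Equiv.addRight m)

/-- The two shifted families in `alpha_normalE` have the same sum after reindexing, and the
condition on n + m excludes the central term. -/
lemma alpha_comm {m n : ℤ} (h : n + m ≠ 0) (v : Fock) :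
    alpha m (alpha n v) = alpha n (alpha m v) := by
  have hs := finsum_shift (fun a => normalE (a - (n + m)) a v) m
  have e : ∀ a, normalE (a + m - (n + m)) (a + m) v = normalE (a - n) (a + m) v := fun a => by
    congr 2; ring_nf
  simp only [e] at hs
  have hf := normalE_support_finite (n + m) v
  have hf' : (Function.support fun a => normalE (a - n) (a + m) v).Finite := by
    have := hf.preimage (f := fun a => a + m) (add_left_injective m).injOn
    refine this.subset fun a ha => ?_
    rw [Set.mem_preimage, Function.mem_support, e]
    exact ha
  rw [show alpha m (alpha n v) = _ from map_alpha (alpha m).toAddMonoidHom n v,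
    alpha_apply n (alpha m v)]
  simp only [LinearMap.toAddMonoidHom_coe, alpha_normalE, if_neg h, add_zero]
  rw [finsum_sub_distrib ?_ hf', finsum_add_distrib (normalE_support_finite _ _) hf, hs,
    add_sub_cancel_right]
  exact ((normalE_support_finite n (alpha m v)).union hf).subset (Function.support_add _ _)

/-! ### Matrix elements of `𝓔_n(z)` -/

/-- The matrix element `∑_k ⟨f, E_{k-n,k} v⟩ e^{z(k-n/2)}`. -/
noncomputable def matE (n : ℤ) (f : Module.Dual ℂ Fock) (v : Fock) : Lau :=
  ∑ᶠ a : ℤ, HahnSeries.C (f (normalE (a - n) a v)) * expL ((a : ℂ) + 1 / 2 - (n : ℂ) / 2)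

/-- The matrix element of `𝓔_n(z)`, including the scalar `1/ς(z)` of `𝓔_0(z)`. -/
noncomputable def matEC (n : ℤ) (f : Module.Dual ℂ Fock) (v : Fock) : Lau :=
  matE n f v + if n = 0 then HahnSeries.C (f v) * (sinhL 1)⁻¹ else 0

lemma matE_support_finite (n : ℤ) (f : Module.Dual ℂ Fock) (v : Fock) (c : ℤ → Lau) :
    (Function.support fun a : ℤ => HahnSeries.C (f (normalE (a - n) a v)) * c a).Finite :=
  normalE_family_finite n v (fun a w => HahnSeries.C (f w) * c a) fun a => by simp

/-- Transfers identities in ℂ((z)) back to the operators in the definition of the Hurwitz numbers.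
-/
lemma coeff_matE (n : ℤ) (d : ℕ) (f : Module.Dual ℂ Fock) (v : Fock) :
    (matE n f v).coeff (d : ℤ) = f (PowerSeries.coeff d (calE n) v) := by
  have h1 := (HahnSeries.coeff.addMonoidHom (R := ℂ) (d : ℤ)).map_finsum
    (matE_support_finite n f v fun a => expL ((a : ℂ) + 1 / 2 - (n : ℂ) / 2))
  have h2 := f.toAddMonoidHom.map_finsum (normalE_family_finite n v
    (fun a w => PowerSeries.coeff d
      (PowerSeries.rescale ((a : ℂ) + 1 / 2 - (n : ℂ) / 2) (PowerSeries.exp ℂ)) • w)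
    fun a => smul_zero _)
  rw [coeff_calE_apply]
  refine h1.trans (Eq.trans (finsum_congr fun a => ?_) h2.symm)
  change (HahnSeries.C _ * expL _).coeff (d : ℤ) = f (_ • _)
  rw [HahnSeries.C_mul_eq_smul, HahnSeries.coeff_smul, coeff_expL, map_smul, smul_eq_mul,
    smul_eq_mul, mul_comm]

/-- The constants differ only for -m ≤ a < 0, so the central terms form a geometric sum equal to
ς(mz)/ς(z). This is why 𝓔_0 needs the scalar 1/ς(z). -/
lemma anomaly_sum (m : ℕ) (x : ℂ) : ∑ᶠ a : ℤ,
    HahnSeries.C ((if a < 0 then x else 0) - (if a + m < 0 then x else 0)) *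
      expL ((a : ℂ) + 1 / 2 - ((-m : ℤ) : ℂ) / 2) = HahnSeries.C x * (sinhL m * (sinhL 1)⁻¹) := by
  -- Translating the index by m moves the support from [-m, 0) to [0, m).
  rw [← sinhL_one_mul_sum, mul_comm (sinhL 1), mul_inv_cancel_right₀ sinhL_one_ne_zero, ← finsum_shift _ (-m),
    finsum_eq_sum_of_support_subset (s := (Finset.range m).map Nat.castEmbedding),
    Finset.sum_map, Finset.mul_sum]
  · refine Finset.sum_congr rfl fun i hi => ?_
    rw [Finset.mem_range] at hi
    have e : ((Nat.castEmbedding i : ℤ)) = (i : ℤ) := rfl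
    rw [e, if_pos (by omega), if_neg (by omega), sub_zero]
    congr 2
    push_cast
    ring
  · intro a ha
    rw [Function.mem_support] at ha
    simp only [Finset.coe_map, Finset.coe_range, Set.mem_image, Set.mem_Iio]
    by_contra hn
    apply ha
    have : ¬ (0 ≤ a ∧ a < m) := fun h => hn ⟨a.toNat, by omega, by
      change ((a.toNat : ℕ) : ℤ) = a
      omega⟩
    by_cases h0 : a < 0
    · rw [if_pos (by omega), if_pos (by omega), sub_self, map_zero, zero_mul]
    · rw [if_neg (by omega), if_neg (by omega), sub_self, map_zero, zero_mul]

lemma expL_sub_expL (n a : ℤ) (m : ℕ+) :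
    expL ((a : ℂ) + 1 / 2 - (n : ℂ) / 2) - expL (((a - m : ℤ) : ℂ) + 1 / 2 - (n : ℂ) / 2) =
      sinhL m * expL ((a : ℂ) + 1 / 2 - ((n + m : ℤ) : ℂ) / 2) := by
  rw [sinhL, sub_mul, ← expL_add, ← expL_add]
  congr 2 <;> push_cast <;> ring

/-- The commutator [α_m, 𝓔_n(z)] = ς(mz) 𝓔_{n+m}(z) in weak form. After a shift by m, the two
families of `alpha_normalE` differ only in their exponentials, whose difference has the factor
ς(mz); the central terms supply the scalar of 𝓔_0. -/
lemma matEC_comp_alpha (n : ℤ) (m : ℕ+) (f : Module.Dual ℂ Fock) (v : Fock) :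
    matEC n (f ∘ₗ alpha m) v = matEC n f (alpha m v) + sinhL m * matEC (n + m) f v := by
  set c : ℤ → Lau := fun a => expL ((a : ℂ) + 1 / 2 - (n : ℂ) / 2) with hc
  have e1 : ∀ a : ℤ, (f ∘ₗ alpha m) (normalE (a - n) a v) = f (normalE (a - n) a (alpha m v)) +
      f (normalE (a - (n + m)) a v) - f (normalE (a - n) (a + m) v) +
      if n + m = 0 then (if a < 0 then f v else 0) - (if a + (m : ℕ) < 0 then f v else 0)
        else 0 := by
    intro a
    rw [LinearMap.comp_apply, alpha_normalE, map_add, map_sub, map_add]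
    congr 1
    split_ifs <;> simp
  have hB : ∀ g : ℤ → Lau, (Function.support fun a : ℤ =>
      HahnSeries.C (f (normalE (a - (n + m)) a v)) * g a).Finite :=
    fun g => matE_support_finite (n + m) f v g
  have hA := matE_support_finite n f (alpha m v) c
  have hD0 : ∀ a : ℤ, HahnSeries.C (f (normalE (a + m - (n + m)) (a + m) v)) * c (a + m - m) =
      HahnSeries.C (f (normalE (a - n) (a + m) v)) * c a := fun a => by
    rw [add_sub_cancel_right, add_sub_add_right_eq_sub]
  have hD : (Function.support fun a : ℤ =>
      HahnSeries.C (f (normalE (a - n) (a + m) v)) * c a).Finite := by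
    refine ((hB fun a => c (a - m)).preimage (f := fun a : ℤ => a + m)
      (add_left_injective _).injOn).subset fun a ha => ?_
    rw [Set.mem_preimage, Function.mem_support, hD0]
    exact ha
  have hZ : (Function.support fun a : ℤ => HahnSeries.C (if n + m = 0 then
      (if a < 0 then f v else 0) - (if a + (m : ℕ) < 0 then f v else 0) else 0) * c a).Finite := by
    refine (Set.finite_Ico (-(m : ℕ) : ℤ) 0).subset fun a ha => ?_
    by_contra h
    apply ha
    rw [Set.mem_Ico] at h
    by_cases h0 : a < 0
    · simp only [if_pos h0, if_pos (show a + (m : ℕ) < 0 by omega), sub_self, ite_self, map_zero,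
        zero_mul]
    · simp only [if_neg h0, if_neg (show ¬ a + (m : ℕ) < 0 by omega), sub_self, ite_self, map_zero,
        zero_mul]
  have hsplit : matE n (f ∘ₗ alpha m) v = matE n f (alpha m v) +
      ((∑ᶠ a : ℤ, HahnSeries.C (f (normalE (a - (n + m)) a v)) * c a) -
        ∑ᶠ a : ℤ, HahnSeries.C (f (normalE (a - n) (a + m) v)) * c a) +
      ∑ᶠ a : ℤ, HahnSeries.C (if n + m = 0 then
        (if a < 0 then f v else 0) - (if a + (m : ℕ) < 0 then f v else 0) else 0) * c a := by
    unfold matE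
    rw [← finsum_sub_distrib (hB c) hD, ← finsum_add_distrib hA, ← finsum_add_distrib ?_ hZ]
    · refine finsum_congr fun a => ?_
      rw [e1, map_add, map_sub, map_add]
      ring
    · exact (hA.union (((hB c).union hD).subset (Function.support_sub _ _))).subset
        (Function.support_add _ _)
    · exact ((hB c).union hD).subset (Function.support_sub _ _)
  have hshift : ∑ᶠ a : ℤ, HahnSeries.C (f (normalE (a - n) (a + m) v)) * c a =
      ∑ᶠ a : ℤ, HahnSeries.C (f (normalE (a - (n + m)) a v)) * c (a - m) := by
    rw [← finsum_shift (fun a : ℤ => HahnSeries.C (f (normalE (a - (n + m)) a v)) * c (a - m)) m]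
    exact finsum_congr fun a => (hD0 a).symm
  have hmain : (∑ᶠ a : ℤ, HahnSeries.C (f (normalE (a - (n + m)) a v)) * c a) -
        ∑ᶠ a : ℤ, HahnSeries.C (f (normalE (a - n) (a + m) v)) * c a =
      sinhL m * matE (n + m) f v := by
    rw [hshift, ← finsum_sub_distrib (hB c) (hB _), matE, mul_finsum' _ (sinhL m) (hB _)]
    refine finsum_congr fun a => ?_
    rw [← mul_sub, hc]
    dsimp only
    rw [expL_sub_expL, mul_left_comm]
  have hzero : (∑ᶠ a : ℤ, HahnSeries.C (if n + m = 0 then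
        (if a < 0 then f v else 0) - (if a + (m : ℕ) < 0 then f v else 0) else 0) * c a) =
      sinhL m * if n + m = 0 then HahnSeries.C (f v) * (sinhL 1)⁻¹ else 0 := by
    by_cases h : n + m = 0
    · have hn : n = -((m : ℕ) : ℤ) := by omega
      simp only [if_pos h, hc]
      rw [hn, anomaly_sum]
      ring
    · simp only [if_neg h, map_zero, zero_mul, finsum_zero, mul_zero]
  rw [matEC, matEC, matEC, hsplit, hmain, hzero, LinearMap.comp_apply]
  ring

/-- For n ≤ 0, the leftmost fermion of every normally ordered summand is killed by ⟨0|. -/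
lemma matE_vac_of_nonpos {n : ℤ} (hn : n ≤ 0) (v : Fock) : matE n vac v = 0 := by
  refine finsum_eq_zero_of_forall_eq_zero fun a => ?_
  have : vac (normalE (a - n) a v) = 0 := by
    unfold normalE
    split_ifs with h
    · exact vac_psi (by omega) _
    · rw [LinearMap.neg_apply, map_neg, neg_eq_zero]
      exact vac_psiDag (by omega) _
  rw [this, map_zero, zero_mul]

/-- Only summands with 0 ≤ a and a - n < 0 survive: ψ† acts at a positive position and ψ at a
negative one. -/
lemma matE_vac (n : ℕ) (v : Fock) : matE n vac v =
    ∑ a ∈ Finset.range n, HahnSeries.C (vac (psi (a - n) (psiDag a v))) * expL ((a : ℂ) + 1 / 2 - n / 2) := by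
  unfold matE
  rw [finsum_eq_sum_of_support_subset (s := (Finset.range n).map Nat.castEmbedding),
    Finset.sum_map]
  · refine Finset.sum_congr rfl fun i hi => ?_
    have e : ((Nat.castEmbedding i : ℤ)) = (i : ℤ) := rfl
    rw [e, normalE, if_pos (by omega), Module.End.mul_apply]
    push_cast
    rfl
  · intro a ha
    rw [Function.mem_support] at ha
    simp only [Finset.coe_map, Finset.coe_range, Set.mem_image, Set.mem_Iio]
    by_contra hn
    apply ha
    have h0 : ¬ (0 ≤ a ∧ a < n) := fun h => hn ⟨a.toNat, by omega, by
      change ((a.toNat : ℕ) : ℤ) = a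
      omega⟩
    have : vac (normalE (a - n) a v) = 0 := by
      unfold normalE
      split_ifs with h
      · exact vac_psi (by omega) _
      · rw [LinearMap.neg_apply, map_neg, neg_eq_zero]
        exact vac_psiDag (by omega) _
    rw [this, map_zero, zero_mul]

/-! ### The recursion for the covectors `⟨0| 𝓔_n(z)` -/

section HookRecursion

variable {K : Type*} [Field K]

lemma sum_eq_zero_of_swap [CharZero K] {ι : Type*} (s : Finset ι) (σ : ι → ι) (hσ : ∀ x ∈ s, σ x ∈ s)
    (hσσ : ∀ x ∈ s, σ (σ x) = x) (g : ι → K) (hg : ∀ x ∈ s, g (σ x) = -g x) :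
    ∑ x ∈ s, g x = 0 := by
  have h : ∑ x ∈ s, g x = ∑ x ∈ s, g (σ x) :=
    Finset.sum_nbij' σ σ hσ hσ hσσ hσσ fun x hx => by rw [hσσ x hx]
  rw [Finset.sum_congr rfl hg, Finset.sum_neg_distrib] at h
  exact self_eq_neg.1 h

/-- Quadruples `((i, j), (a, b))` with `i + j + a + b + 1 = M`. -/
def quads (M : ℕ) : Finset ((ℕ × ℕ) × (ℕ × ℕ)) :=
  (((Finset.range M) ×ˢ (Finset.range M)) ×ˢ ((Finset.range M) ×ˢ (Finset.range M))).filter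
    fun x => x.1.1 + x.1.2 + x.2.1 + x.2.2 + 1 = M

lemma mem_quads {M : ℕ} {x : (ℕ × ℕ) × (ℕ × ℕ)} :
    x ∈ quads M ↔ x.1.1 + x.1.2 + x.2.1 + x.2.2 + 1 = M := by
  simp only [quads, Finset.mem_filter, Finset.mem_product, Finset.mem_range]
  omega

lemma sum_quads (M : ℕ) (g : ℕ × ℕ → ℕ × ℕ → K) :
    ∑ l ∈ Finset.range M, ∑ p ∈ Finset.HasAntidiagonal.antidiagonal (M - 1 - l),
      ∑ s ∈ Finset.HasAntidiagonal.antidiagonal l, g s p = ∑ x ∈ quads M, g x.1 x.2 := by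
  rw [Finset.sum_congr rfl fun l _ =>
    (Finset.sum_product' (Finset.HasAntidiagonal.antidiagonal (M - 1 - l)) (Finset.HasAntidiagonal.antidiagonal l)
      fun p s => g s p).symm, Finset.sum_sigma']
  refine Finset.sum_nbij' (fun x => (x.2.2, x.2.1)) (fun x => ⟨x.1.1 + x.1.2, (x.2, x.1)⟩)
    ?_ ?_ ?_ ?_ ?_
  · rintro ⟨l, p, s⟩ h
    simp only [Finset.mem_sigma, Finset.mem_range, Finset.mem_product, Finset.HasAntidiagonal.mem_antidiagonal] at h
    rw [mem_quads]
    dsimp only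
    omega
  · rintro ⟨⟨i, j⟩, ⟨a, b⟩⟩ h
    rw [mem_quads] at h
    dsimp only at h
    simp only [Finset.mem_sigma, Finset.mem_range, Finset.mem_product,
      Finset.HasAntidiagonal.mem_antidiagonal, and_true]
    omega
  · rintro ⟨l, p, s⟩ h
    simp only [Finset.mem_sigma, Finset.mem_range, Finset.mem_product, Finset.HasAntidiagonal.mem_antidiagonal] at h
    obtain ⟨-, -, rfl⟩ := h
    rfl
  · intro x _
    rfl
  · intro x _
    rfl

/-- Multiplied out, the part with positive exponent depends on i and a only through i + a, the part
with negative exponent on j and b only through j + b. Each is therefore killed by the corresponding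
antisymmetry of q. -/
lemma sum_quads_eq_zero [CharZero K] (M : ℕ) (E : ℂ → K) (hE : ∀ x y, E (x + y) = E x * E y)
    (q : ℕ → ℕ → ℕ → ℕ → K) (hq1 : ∀ i j a b, q a j i b = -q i j a b)
    (hq2 : ∀ i j a b, q i b a j = -q i j a b) :
    ∑ x ∈ quads M, (E ((x.1.1 + x.1.2 + 1) / 2) - E (-((x.1.1 + x.1.2 + 1) / 2))) *
      (q x.1.1 x.1.2 x.2.1 x.2.2 * E ((x.2.1 - x.2.2) / 2)) = 0 := by
  have h1 : ∑ x ∈ quads M, E ((x.1.1 + x.1.2 + 1) / 2) *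
      (q x.1.1 x.1.2 x.2.1 x.2.2 * E ((x.2.1 - x.2.2) / 2)) = 0 := by
    refine sum_eq_zero_of_swap (quads M) (fun x => ((x.2.1, x.1.2), (x.1.1, x.2.2))) ?_ ?_ _ ?_
    · intro x hx
      rw [mem_quads] at hx ⊢
      dsimp only
      omega
    · intro x _
      rfl
    · intro x _
      dsimp only
      rw [hq1, mul_left_comm, mul_left_comm (E _), ← hE, ← hE, neg_mul]
      congr 3
      ring
  have h2 : ∑ x ∈ quads M, E (-((x.1.1 + x.1.2 + 1) / 2)) *
      (q x.1.1 x.1.2 x.2.1 x.2.2 * E ((x.2.1 - x.2.2) / 2)) = 0 := by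
    refine sum_eq_zero_of_swap (quads M) (fun x => ((x.1.1, x.2.2), (x.2.1, x.1.2))) ?_ ?_ _ ?_
    · intro x hx
      rw [mem_quads] at hx ⊢
      dsimp only
      omega
    · intro x _
      rfl
    · intro x _
      dsimp only
      rw [hq2, mul_left_comm, mul_left_comm (E _), ← hE, ← hE, neg_mul]
      congr 3
      ring
  simp only [sub_mul, Finset.sum_sub_distrib, h1, h2, sub_zero]

/-- Reindexes by the hook obtained after lengthening the arm by l + 1. -/
lemma sum_arm (M : ℕ) (g : ℕ → ℕ → ℕ → K) :
    ∑ l ∈ Finset.range M, ∑ p ∈ Finset.HasAntidiagonal.antidiagonal (M - 1 - l), g l (p.1 + l + 1) p.2 =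
      ∑ p ∈ Finset.HasAntidiagonal.antidiagonal M, ∑ t ∈ Finset.range p.1, g t p.1 p.2 := by
  rw [Finset.sum_sigma', Finset.sum_sigma']
  refine Finset.sum_nbij' (fun x => ⟨(x.2.1 + x.1 + 1, x.2.2), x.1⟩)
    (fun x => ⟨x.2, (x.1.1 - 1 - x.2, x.1.2)⟩) ?_ ?_ ?_ ?_ ?_
  · rintro ⟨l, a, b⟩ h
    simp only [Finset.mem_sigma, Finset.mem_range, Finset.HasAntidiagonal.mem_antidiagonal] at h ⊢
    omega
  · rintro ⟨⟨a, b⟩, t⟩ h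
    simp only [Finset.mem_sigma, Finset.mem_range, Finset.HasAntidiagonal.mem_antidiagonal] at h ⊢
    omega
  · rintro ⟨l, a, b⟩ h
    simp
  · rintro ⟨⟨a, b⟩, t⟩ h
    simp only [Finset.mem_sigma, Finset.mem_range, Finset.HasAntidiagonal.mem_antidiagonal] at h
    have : a - 1 - t + t + 1 = a := by omega
    simp [this]
  · intro x _
    rfl

lemma sum_leg (M : ℕ) (g : ℕ → ℕ → ℕ → K) :
    ∑ l ∈ Finset.range M, ∑ p ∈ Finset.HasAntidiagonal.antidiagonal (M - 1 - l), g l p.1 (p.2 + l + 1) =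
      ∑ p ∈ Finset.HasAntidiagonal.antidiagonal M, ∑ t ∈ Finset.range p.2, g t p.1 p.2 := by
  rw [← Finset.Nat.sum_antidiagonal_swap]
  dsimp only [Prod.fst_swap, Prod.snd_swap]
  rw [← sum_arm M fun t a b => g t b a]
  refine Finset.sum_congr rfl fun l _ => ?_
  rw [← Finset.Nat.sum_antidiagonal_swap]
  rfl

/-- The subtracted exponentials, together with the central one, run through all exponents from
-(A+B)/2 to (A+B)/2 in unit steps, which is exactly the last sum. What remains is A + B + 1 copies
of the central exponential. -/
lemma hook_coefficient (E : ℂ → K) (A B : ℕ) :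
    ((A + B + 1 : ℕ) : K) * E (((A : ℂ) - B) / 2) =
      ∑ t ∈ Finset.range A, (E (((A : ℂ) - B) / 2) - E (((A : ℂ) - B) / 2 - (t + 1))) +
      ∑ t ∈ Finset.range B, (E (((A : ℂ) - B) / 2) - E (((A : ℂ) - B) / 2 + (t + 1))) +
      ∑ i ∈ Finset.range (A + B + 1), E (i - ((A + B : ℕ) : ℂ) / 2) := by
  have h1 : ∑ i ∈ Finset.range (A + B + 1), E (i - ((A + B : ℕ) : ℂ) / 2) =
      ∑ t ∈ Finset.range A, E (((A : ℂ) - B) / 2 - (t + 1)) + E (((A : ℂ) - B) / 2) +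
        ∑ t ∈ Finset.range B, E (((A : ℂ) - B) / 2 + (t + 1)) := by
    rw [show A + B + 1 = (A + 1) + B by ring, Finset.sum_range_add, Finset.sum_range_succ,
      ← Finset.sum_range_reflect]
    congr 1
    · congr 1
      · refine Finset.sum_congr rfl fun i hi => ?_
        rw [Finset.mem_range] at hi
        have : ((A - 1 - i : ℕ) : ℂ) = A - 1 - i := by
          rw [Nat.cast_sub (by omega), Nat.cast_sub (by omega), Nat.cast_one]
        rw [this]
        congr 1
        push_cast
        ring
      · congr 1
        push_cast
        ring
    · refine Finset.sum_congr rfl fun i _ => ?_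
      congr 1
      push_cast
      ring
  rw [h1, Finset.sum_sub_distrib, Finset.sum_sub_distrib, Finset.sum_const, Finset.sum_const,
    Finset.card_range, Finset.card_range]
  push_cast
  simp only [nsmul_eq_mul]
  ring

/-- Abstract form of the recursion for N = M + 1. Here h stands for the hook values ⟨0|ψ_{-1-b} ψ†_a
v⟩, q for the four-fermion values, and the bracket is the effect of α_{l+1} on a hook; the last
summand is the term l = M, where 𝓔_0 is a scalar. -/
lemma hook_recursion [CharZero K] (M : ℕ) (E : ℂ → K) (hE : ∀ x y, E (x + y) = E x * E y)
    (h : ℕ → ℕ → K) (q : ℕ → ℕ → ℕ → ℕ → K) (hq1 : ∀ i j a b, q a j i b = -q i j a b)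
    (hq2 : ∀ i j a b, q i b a j = -q i j a b) :
    ((M + 1 : ℕ) : K) * ∑ p ∈ Finset.HasAntidiagonal.antidiagonal M, h p.1 p.2 * E ((p.1 - p.2) / 2) =
      ∑ l ∈ Finset.range M, (E (((l + 1 : ℕ) : ℂ) / 2) - E (-(((l + 1 : ℕ) : ℂ) / 2))) *
        ∑ p ∈ Finset.HasAntidiagonal.antidiagonal (M - 1 - l),
          ((∑ s ∈ Finset.HasAntidiagonal.antidiagonal l, q s.1 s.2 p.1 p.2) - h p.1 (p.2 + l + 1) +
            h (p.1 + l + 1) p.2) * E ((p.1 - p.2) / 2) +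
      (∑ i ∈ Finset.range (M + 1), E (i - (M : ℂ) / 2)) *
        ∑ p ∈ Finset.HasAntidiagonal.antidiagonal M, h p.1 p.2 := by
  have hQ : ∑ l ∈ Finset.range M, ∑ p ∈ Finset.HasAntidiagonal.antidiagonal (M - 1 - l),
      ∑ s ∈ Finset.HasAntidiagonal.antidiagonal l, (E (((l + 1 : ℕ) : ℂ) / 2) - E (-(((l + 1 : ℕ) : ℂ) / 2))) *
        (q s.1 s.2 p.1 p.2 * E ((p.1 - p.2) / 2)) = 0 := by
    rw [← sum_quads_eq_zero M E hE q hq1 hq2, ← sum_quads M fun s p =>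
      (E ((s.1 + s.2 + 1) / 2) - E (-((s.1 + s.2 + 1) / 2))) *
        (q s.1 s.2 p.1 p.2 * E ((p.1 - p.2) / 2))]
    refine Finset.sum_congr rfl fun l _ => Finset.sum_congr rfl fun p _ =>
      Finset.sum_congr rfl fun s hs => ?_
    rw [Finset.HasAntidiagonal.mem_antidiagonal] at hs
    subst hs
    push_cast
    rfl
  have hA : ∑ l ∈ Finset.range M, ∑ p ∈ Finset.HasAntidiagonal.antidiagonal (M - 1 - l),
      (E (((l + 1 : ℕ) : ℂ) / 2) - E (-(((l + 1 : ℕ) : ℂ) / 2))) *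
        (h (p.1 + l + 1) p.2 * E ((p.1 - p.2) / 2)) =
      ∑ p ∈ Finset.HasAntidiagonal.antidiagonal M, ∑ t ∈ Finset.range p.1,
        (E (((p.1 : ℂ) - p.2) / 2) - E (((p.1 : ℂ) - p.2) / 2 - (t + 1))) * h p.1 p.2 := by
    rw [← sum_arm M fun t a b =>
      (E (((a : ℂ) - b) / 2) - E (((a : ℂ) - b) / 2 - (t + 1))) * h a b]
    refine Finset.sum_congr rfl fun l _ => Finset.sum_congr rfl fun p _ => ?_
    rw [mul_left_comm, sub_mul, ← hE, ← hE, mul_comm]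
    congr 3 <;> push_cast <;> ring
  have hB : ∑ l ∈ Finset.range M, ∑ p ∈ Finset.HasAntidiagonal.antidiagonal (M - 1 - l),
      (E (((l + 1 : ℕ) : ℂ) / 2) - E (-(((l + 1 : ℕ) : ℂ) / 2))) *
        (h p.1 (p.2 + l + 1) * E ((p.1 - p.2) / 2)) =
      -∑ p ∈ Finset.HasAntidiagonal.antidiagonal M, ∑ t ∈ Finset.range p.2,
        (E (((p.1 : ℂ) - p.2) / 2) - E (((p.1 : ℂ) - p.2) / 2 + (t + 1))) * h p.1 p.2 := by
    rw [← sum_leg M fun t a b =>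
      (E (((a : ℂ) - b) / 2) - E (((a : ℂ) - b) / 2 + (t + 1))) * h a b, ← Finset.sum_neg_distrib]
    refine Finset.sum_congr rfl fun l _ => ?_
    rw [← Finset.sum_neg_distrib]
    refine Finset.sum_congr rfl fun p _ => ?_
    rw [mul_left_comm, sub_mul, ← hE, ← hE, mul_comm, ← neg_mul, neg_sub]
    congr 3 <;> push_cast <;> ring
  have hR : ∑ l ∈ Finset.range M, (E (((l + 1 : ℕ) : ℂ) / 2) - E (-(((l + 1 : ℕ) : ℂ) / 2))) *
        ∑ p ∈ Finset.HasAntidiagonal.antidiagonal (M - 1 - l),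
          ((∑ s ∈ Finset.HasAntidiagonal.antidiagonal l, q s.1 s.2 p.1 p.2) - h p.1 (p.2 + l + 1) +
            h (p.1 + l + 1) p.2) * E ((p.1 - p.2) / 2) =
      (∑ p ∈ Finset.HasAntidiagonal.antidiagonal M, ∑ t ∈ Finset.range p.1,
        (E (((p.1 : ℂ) - p.2) / 2) - E (((p.1 : ℂ) - p.2) / 2 - (t + 1))) * h p.1 p.2) +
      ∑ p ∈ Finset.HasAntidiagonal.antidiagonal M, ∑ t ∈ Finset.range p.2,
        (E (((p.1 : ℂ) - p.2) / 2) - E (((p.1 : ℂ) - p.2) / 2 + (t + 1))) * h p.1 p.2 := by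
    rw [← hA, ← sub_neg_eq_add, ← hB]
    -- The vanishing four-fermion sum is put back so that the identity holds summand by summand.
    refine Eq.trans ?_ ((congrArg (· + (_ - _)) hQ).trans (zero_add _))
    simp only [← Finset.sum_sub_distrib, ← Finset.sum_add_distrib, Finset.mul_sum]
    refine Finset.sum_congr rfl fun l _ => Finset.sum_congr rfl fun p _ => ?_
    rw [← Finset.mul_sum, ← Finset.sum_mul]
    ring
  rw [hR, Finset.mul_sum, Finset.mul_sum, ← Finset.sum_add_distrib, ← Finset.sum_add_distrib]
  refine Finset.sum_congr rfl fun p hp => ?_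
  rw [Finset.HasAntidiagonal.mem_antidiagonal] at hp
  rw [← hp, ← Finset.sum_mul, ← Finset.sum_mul, ← add_mul, ← add_mul, ← hook_coefficient]
  ring

end HookRecursion

/-! ### Recursion for the vacuum covector in terms of fermions -/

instance : CharZero Lau := charZero_of_injective_ringHom (HahnSeries.C_injective (Γ := ℤ) (R := ℂ))

lemma matEC_vac_of_neg {n : ℤ} (hn : n < 0) (v : Fock) : matEC n vac v = 0 := by
  rw [matEC, matE_vac_of_nonpos hn.le, if_neg hn.ne, add_zero]

lemma matEC_vac_zero (v : Fock) : matEC 0 vac v = HahnSeries.C (vac v) * (sinhL 1)⁻¹ := by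
  rw [matEC, matE_vac_of_nonpos le_rfl, if_pos rfl, zero_add]

/-- With b = M - a, the exponent a + 1/2 - (M+1)/2 becomes (a-b)/2 and the position a - (M+1)
becomes -1 - b. -/
lemma matEC_vac_succ (M : ℕ) (v : Fock) : matEC (M + 1 : ℕ) vac v =
    ∑ p ∈ Finset.HasAntidiagonal.antidiagonal M,
      HahnSeries.C (vac (psi (-1 - p.2) (psiDag p.1 v))) * expL ((p.1 - p.2) / 2) := by
  rw [matEC, if_neg (by omega), add_zero, matE_vac, Finset.Nat.sum_antidiagonal_eq_sum_range_succ_mk]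
  refine Finset.sum_congr rfl fun a ha => ?_
  rw [Finset.mem_range] at ha
  congr 1
  · congr 4
    push_cast [Nat.cast_sub (show a ≤ M by omega)]
    ring
  · congr 1
    push_cast [Nat.cast_sub (show a ≤ M by omega)]
    ring

lemma vac_alpha_succ (l : ℕ) (v : Fock) : vac (alpha (l + 1 : ℕ) v) =
    ∑ p ∈ Finset.HasAntidiagonal.antidiagonal l, vac (psi (-1 - p.2) (psiDag p.1 v)) := by
  have h1 := coeff_matE (l + 1 : ℕ) 0 vac v
  have h2 := matEC_vac_succ l v
  rw [matEC, if_neg (by omega), add_zero] at h2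
  rw [alpha, ← PowerSeries.coeff_zero_eq_constantCoeff_apply, ← h1, h2, HahnSeries.coeff_sum]
  refine Finset.sum_congr rfl fun p _ => ?_
  rw [HahnSeries.C_mul_eq_smul, HahnSeries.coeff_smul, coeff_expL]
  simp

lemma psi_psiDag_alpha (m a b : ℤ) (v : Fock) : psi b (psiDag a (alpha m v)) =
    alpha m (psi b (psiDag a v)) - psi (b - m) (psiDag a v) + psi b (psiDag (a + m) v) := by
  rw [alpha_psi, alpha_psiDag, map_sub]
  abel

lemma matEC_vac_recursion (M : ℕ) (v : Fock) : ((M + 1 : ℕ) : Lau) * matEC (M + 1 : ℕ) vac v =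
    ∑ l ∈ Finset.range (M + 1),
      sinhL ((l + 1 : ℕ) : ℂ) * matEC (M - l : ℕ) vac (alpha (l + 1 : ℕ) v) := by
  have key := hook_recursion M expL expL_add
    (fun a b => HahnSeries.C (vac (psi (-1 - b) (psiDag a v))))
    (fun i j a b => HahnSeries.C (vac (psi (-1 - j) (psiDag i (psi (-1 - b) (psiDag a v))))))
    -- The positions i and a are nonnegative while -1-j and -1-b are negative, so the fermions
    -- anticommute without contractions.
    (fun i j a b => by
      rw [psiDag_psi, psiDag_psi, if_neg (by omega), if_neg (by omega), psiDag_psiDag]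
      simp only [zero_sub, map_neg])
    (fun i j a b => by
      rw [psiDag_psi, psiDag_psi, if_neg (by omega), if_neg (by omega), map_sub, map_sub, psi_psi]
      simp only [map_zero, zero_sub, map_neg])
  rw [matEC_vac_succ, key]
  -- The term l = M involves 𝓔_0, on which ⟨0| sees only the scalar 1/ς(z); it matches the separate
  -- summand of `hook_recursion`.
  conv_rhs => rw [Finset.sum_range_succ]
  congr 1
  · refine Finset.sum_congr rfl fun l hl => ?_
    rw [Finset.mem_range] at hl
    rw [show M - l = M - 1 - l + 1 by omega, matEC_vac_succ, sinhL]
    congr 1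
    refine Finset.sum_congr rfl fun p _ => ?_
    congr 1
    have e1 : -1 - ((p.2 + l + 1 : ℕ) : ℤ) = -1 - p.2 - ((l + 1 : ℕ) : ℤ) := by
      push_cast
      ring
    have e2 : ((p.1 + l + 1 : ℕ) : ℤ) = p.1 + ((l + 1 : ℕ) : ℤ) := by
      push_cast
      ring
    rw [psi_psiDag_alpha, map_add, map_sub, vac_alpha_succ, map_add, map_sub, map_sum, e1, e2]
  · rw [Nat.sub_self, Nat.cast_zero, matEC_vac_zero, vac_alpha_succ, map_sum,
      ← sinhL_one_mul_sum]
    have e : ∀ i ∈ Finset.range (M + 1), expL ((i : ℂ) + 1 / 2 - ((M + 1 : ℕ) : ℂ) / 2) =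
        expL ((i : ℂ) - (M : ℂ) / 2) := fun i _ => by
      congr 1
      push_cast
      ring
    rw [Finset.sum_congr rfl e, mul_comm (sinhL 1), mul_assoc, mul_left_comm (sinhL 1),
      mul_inv_cancel₀ sinhL_one_ne_zero, mul_one]

/-! ### Sums over multisets -/

section Multisets

variable {α : Type*} [DecidableEq α]

/-- The product of the factorials of the multiplicities. -/
def multFact (M : Multiset α) : ℕ := ∏ a ∈ M.toFinset, (M.count a).factorial

lemma multFact_eq_prod {M : Multiset α} {s : Finset α} (h : M.toFinset ⊆ s) :
    multFact M = ∏ a ∈ s, (M.count a).factorial :=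
  Finset.prod_subset h fun a _ ha => by
    rw [Multiset.mem_toFinset, ← Multiset.count_eq_zero] at ha
    rw [ha, Nat.factorial_zero]

lemma multFact_zero : multFact (0 : Multiset α) = 1 := rfl

lemma multFact_pos (M : Multiset α) : 0 < multFact M :=
  Finset.prod_pos fun _ _ => Nat.factorial_pos _

lemma multFact_cons (a : α) (M : Multiset α) :
    multFact (a ::ₘ M) = (a ::ₘ M).count a * multFact M := by
  have h1 : M.toFinset ⊆ (a ::ₘ M).toFinset := by
    rw [Multiset.toFinset_cons]
    exact Finset.subset_insert _ _
  have ha : a ∈ (a ::ₘ M).toFinset := by simp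
  rw [multFact_eq_prod h1, multFact, ← Finset.mul_prod_erase _ _ ha, ← Finset.mul_prod_erase _ _ ha,
    Multiset.count_cons_self, Nat.factorial_succ, mul_assoc]
  congr 2
  refine Finset.prod_congr rfl fun b hb => ?_
  rw [Multiset.count_cons_of_ne (Finset.ne_of_mem_erase hb)]

lemma multFact_erase {a : α} {M : Multiset α} (ha : a ∈ M) :
    multFact M = M.count a * multFact (M.erase a) := by
  conv_lhs => rw [← Multiset.cons_erase ha, multFact_cons, Multiset.cons_erase ha]

/-- The lists whose multiset of elements is `M`. -/
def listsOf (M : Multiset α) : Finset (List α) := M.lists.toFinset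

lemma mem_listsOf {M : Multiset α} {l : List α} : l ∈ listsOf M ↔ (l : Multiset α) = M := by
  rw [listsOf, Multiset.mem_toFinset, Multiset.mem_lists_iff, eq_comm]
  rfl

lemma card_listsOf_eq_sum (M : Multiset α) (hM : M ≠ 0) :
    (listsOf M).card = ∑ a ∈ M.toFinset, (listsOf (M.erase a)).card := by
  have h : listsOf M = M.toFinset.biUnion fun a => (listsOf (M.erase a)).image (List.cons a) := by
    ext l
    simp only [Finset.mem_biUnion, Finset.mem_image, mem_listsOf, Multiset.mem_toFinset]
    constructor
    · rintro rfl
      rcases l with _ | ⟨a, l⟩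
      · exact absurd rfl hM
      · exact ⟨a, by simp, l, by simp, rfl⟩
    · rintro ⟨a, ha, l, hl, rfl⟩
      rw [← Multiset.cons_coe, hl, Multiset.cons_erase ha]
  rw [h, Finset.card_biUnion]
  · exact Finset.sum_congr rfl fun a _ => Finset.card_image_of_injective _ List.cons_injective
  · intro a _ b _ hab
    rw [Function.onFun_apply, Finset.disjoint_left]
    intro l hl hl'
    simp only [Finset.mem_image] at hl hl'
    obtain ⟨l1, -, rfl⟩ := hl
    obtain ⟨l2, -, h2⟩ := hl'
    exact hab (List.cons.inj h2).1.symm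

/-- The multinomial count of orderings, by induction on the first entry: a first entry a contributes
in proportion to its multiplicity. -/
lemma card_listsOf_mul_multFact (M : Multiset α) :
    (listsOf M).card * multFact M = M.card.factorial := by
  induction h : M.card generalizing M with
  | zero =>
    rw [Multiset.card_eq_zero] at h
    subst h
    have : listsOf (0 : Multiset α) = {[]} := by
      ext l
      rw [mem_listsOf, Finset.mem_singleton, Multiset.coe_eq_zero]
    rw [this]
    rfl
  | succ n ih =>
    have hM : M ≠ 0 := by
      rintro rfl
      simp at h
    rw [card_listsOf_eq_sum M hM, Finset.sum_mul, Nat.factorial_succ, ← h,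
      ← Multiset.toFinset_sum_count_eq M, Finset.sum_mul]
    refine Finset.sum_congr rfl fun a ha => ?_
    rw [Multiset.mem_toFinset] at ha
    rw [multFact_erase ha, ← ih (M.erase a) (by rw [Multiset.card_erase_of_mem ha, h]; rfl)]
    ring

variable {K : Type*} [Field K]

/-- Replaces the weight 1/n! on ordered tuples by 1/|Aut M| on multisets; this is how sums over
tuples are converted throughout. -/
lemma sum_listsOf [CharZero K] (M : Multiset α) (c : K) :
    ∑ l ∈ listsOf M, ((l.length.factorial : K))⁻¹ * c = (multFact M : K)⁻¹ * c := by
  have h : ∀ l ∈ listsOf M, ((l.length.factorial : K))⁻¹ * c = (M.card.factorial : K)⁻¹ * c := by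
    intro l hl
    rw [mem_listsOf] at hl
    rw [← hl, Multiset.coe_card]
  have h1 : (multFact M : K) ≠ 0 := by exact_mod_cast (multFact_pos M).ne'
  have h2 : ((listsOf M).card : K) ≠ 0 := by
    intro h0
    have := card_listsOf_mul_multFact M
    rw [Nat.cast_eq_zero.1 h0, zero_mul] at this
    exact (Nat.factorial_pos _).ne this
  rw [Finset.sum_congr rfl h, Finset.sum_const, nsmul_eq_mul, ← card_listsOf_mul_multFact]
  push_cast
  field_simp

lemma sum_Icc_cons_left (a : α) (M : Multiset α) (g : Multiset α → K)
    (hg : ∀ I, a ∉ I → g I = 0) :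
    ∑ I ∈ Finset.Icc 0 (a ::ₘ M), g I = ∑ I ∈ Finset.Icc 0 M, g (a ::ₘ I) := by
  symm
  refine (Finset.sum_map (Finset.Icc 0 M)
    ⟨Multiset.cons a, fun _ _ => (Multiset.cons_inj_right a).1⟩ g).symm.trans ?_
  refine Finset.sum_subset ?_ ?_
  · intro I hI
    simp only [Finset.mem_map, Finset.mem_Icc] at hI ⊢
    obtain ⟨I', ⟨-, h⟩, rfl⟩ := hI
    exact ⟨Multiset.zero_le _, Multiset.cons_le_cons a h⟩
  · intro I hI hI'
    refine hg I fun ha => hI' ?_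
    simp only [Finset.mem_map, Finset.mem_Icc] at hI ⊢
    exact ⟨I.erase a, ⟨Multiset.zero_le _, Multiset.erase_le_iff_le_cons.2 hI.2⟩,
      Multiset.cons_erase ha⟩

lemma sum_Icc_cons_right (a : α) (M : Multiset α) (g : Multiset α → K)
    (hg : ∀ I ≤ a ::ₘ M, a ∉ a ::ₘ M - I → g I = 0) :
    ∑ I ∈ Finset.Icc 0 (a ::ₘ M), g I = ∑ I ∈ Finset.Icc 0 M, g I := by
  symm
  refine Finset.sum_subset (Finset.Icc_subset_Icc_right (Multiset.le_cons_self M a)) ?_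
  intro I hI hI'
  rw [Finset.mem_Icc] at hI hI'
  refine hg I hI.2 fun ha => hI' ⟨hI.1, ?_⟩
  rw [Multiset.le_iff_count]
  intro b
  have h1 := Multiset.le_iff_count.1 hI.2 b
  by_cases hb : b = a
  · subst hb
    rw [← Multiset.count_pos, Multiset.count_sub, Multiset.count_cons_self] at ha
    omega
  · rwa [Multiset.count_cons_of_ne hb] at h1

/-- The antidiagonal lists each splitting M = I + J with multiplicity |Aut M| / (|Aut I| |Aut J|).
-/
lemma sum_antidiagonal_eq [CharZero K] (M : Multiset α) (f : Multiset α → Multiset α → K) :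
    (M.antidiagonal.map fun x => f x.1 x.2).sum = (multFact M : K) *
      ∑ I ∈ Finset.Icc 0 M, (multFact I : K)⁻¹ * (multFact (M - I) : K)⁻¹ * f I (M - I) := by
  induction M using Multiset.induction_on generalizing f with
  | empty => simp [multFact_zero]
  | cons a M ih =>
    have hc : ∀ N : Multiset α, ((a ::ₘ N).count a : K) ≠ 0 := fun N => by
      rw [Multiset.count_cons_self]
      exact Nat.cast_ne_zero.2 (Nat.succ_ne_zero _)
    -- Pascal's rule in weighted form: the multiplicity of a is the sum of its multiplicities in I
    -- and in the complement, matching the two cases in which the new a joins one side.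
    have hsplit : ((a ::ₘ M).count a : K) * ∑ I ∈ Finset.Icc 0 (a ::ₘ M),
          (multFact I : K)⁻¹ * (multFact (a ::ₘ M - I) : K)⁻¹ * f I (a ::ₘ M - I) =
        ∑ I ∈ Finset.Icc 0 (a ::ₘ M), ((a ::ₘ M - I).count a : K) *
          ((multFact I : K)⁻¹ * (multFact (a ::ₘ M - I) : K)⁻¹ * f I (a ::ₘ M - I)) +
        ∑ I ∈ Finset.Icc 0 (a ::ₘ M), (I.count a : K) *
          ((multFact I : K)⁻¹ * (multFact (a ::ₘ M - I) : K)⁻¹ * f I (a ::ₘ M - I)) := by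
      rw [Finset.mul_sum, ← Finset.sum_add_distrib]
      refine Finset.sum_congr rfl fun I hI => ?_
      rw [Finset.mem_Icc] at hI
      rw [← add_mul, ← Nat.cast_add, ← Multiset.count_add, tsub_add_cancel_of_le hI.2]
    rw [Multiset.antidiagonal_cons, Multiset.map_add, Multiset.sum_add, Multiset.map_map,
      Multiset.map_map, multFact_cons, Nat.cast_mul, mul_comm (_ : K) (multFact M : K), mul_assoc,
      hsplit, mul_add]
    congr 1
    · refine (ih fun I J => f I (a ::ₘ J)).trans ?_
      rw [sum_Icc_cons_right]
      · congr 1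
        refine Finset.sum_congr rfl fun I hI => ?_
        rw [Finset.mem_Icc] at hI
        have e : a ::ₘ M - I = a ::ₘ (M - I) := by
          rw [← Multiset.singleton_add, ← Multiset.singleton_add, add_tsub_assoc_of_le hI.2]
        rw [e, multFact_cons, Nat.cast_mul, mul_inv]
        have := hc (M - I)
        field_simp
      · intro I _ h
        rw [Multiset.count_eq_zero.2 h, Nat.cast_zero, zero_mul]
    · refine (ih fun I J => f (a ::ₘ I) J).trans ?_
      rw [sum_Icc_cons_left]
      · congr 1
        refine Finset.sum_congr rfl fun I hI => ?_
        have e : a ::ₘ M - a ::ₘ I = M - I := by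
          rw [← Multiset.singleton_add, ← Multiset.singleton_add, add_tsub_add_eq_tsub_left]
        rw [e, multFact_cons, Nat.cast_mul, mul_inv]
        have := hc I
        field_simp
      · intro I h
        rw [Multiset.count_eq_zero.2 h, Nat.cast_zero, zero_mul]

end Multisets

/-! ### Partitions as multisets of positive integers, and their weights -/

/-- The sum of the parts of a multiset. -/
def msum (M : Multiset ℕ+) : ℕ := (M.map fun a : ℕ+ => (a : ℕ)).sum

lemma msum_cons (a : ℕ+) (M : Multiset ℕ+) : msum (a ::ₘ M) = a + msum M := by simp [msum]

lemma msum_coe (l : List ℕ+) : msum l = partSum l := rfl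

lemma msum_eq_zero {M : Multiset ℕ+} : msum M = 0 ↔ M = 0 := by
  constructor
  · intro h
    induction M using Multiset.induction_on with
    | empty => rfl
    | cons a M _ =>
      rw [msum_cons] at h
      have := a.pos
      omega
  · rintro rfl
    rfl

lemma finite_msum_eq (N : ℤ) : {M : Multiset ℕ+ | (msum M : ℤ) = N}.Finite := by
  refine ((finite_partSum_le N.toNat).image fun l : List ℕ+ => (l : Multiset ℕ+)).subset ?_
  intro M hM
  induction M using Quotient.inductionOn with
  | h l =>
    refine ⟨l, ?_, rfl⟩
    have : (partSum l : ℤ) = N := hM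
    change partSum l ≤ N.toNat
    omega

/-- The multisets of positive integers with sum `N`. -/
noncomputable def partsOf (N : ℤ) : Finset (Multiset ℕ+) := (finite_msum_eq N).toFinset

lemma mem_partsOf {N : ℤ} {M : Multiset ℕ+} : M ∈ partsOf N ↔ (msum M : ℤ) = N :=
  (finite_msum_eq N).mem_toFinset

/-- `∏ ς(a z)` over the elements `a` of a multiset. -/
noncomputable def sinhProd (M : Multiset ℕ+) : Lau := (M.map fun a : ℕ+ => sinhL (a : ℂ)).prod

/-- The product of the elements of a multiset. -/
def mprod (M : Multiset ℕ+) : ℕ := (M.map fun a : ℕ+ => (a : ℕ)).prod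

lemma sinhProd_cons (a : ℕ+) (M : Multiset ℕ+) :
    sinhProd (a ::ₘ M) = sinhL (a : ℂ) * sinhProd M := by simp [sinhProd]

lemma mprod_cons (a : ℕ+) (M : Multiset ℕ+) : mprod (a ::ₘ M) = a * mprod M := by simp [mprod]

lemma mprod_add (M N : Multiset ℕ+) : mprod (M + N) = mprod M * mprod N := by simp [mprod]

/-- Writing N as the sum of count(a)·a over the distinct parts a of L and deleting one copy of a,
the factor count(a)·a cancels against the weight of L and leaves ς(az) times the weight of the rest.
This is the recursion of `matEC_vac_recursion`. -/
lemma sum_partsOf_recursion (N : ℕ) (c : Multiset ℕ+ → Lau) :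
    (N : Lau) * ∑ L ∈ partsOf N, (multFact L : Lau)⁻¹ * (sinhProd L * (mprod L : Lau)⁻¹) * c L =
      ∑ l ∈ Finset.range N, sinhL ((l + 1 : ℕ) : ℂ) * ∑ L ∈ partsOf (N - (l + 1) : ℤ),
        (multFact L : Lau)⁻¹ * (sinhProd L * (mprod L : Lau)⁻¹) * c (l.succPNat ::ₘ L) := by
  have h1 : ∀ L ∈ partsOf N,
      (N : Lau) * ((multFact L : Lau)⁻¹ * (sinhProd L * (mprod L : Lau)⁻¹) * c L) =
      ∑ a ∈ L.toFinset, (L.count a : Lau) * (a : ℕ) *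
        ((multFact L : Lau)⁻¹ * (sinhProd L * (mprod L : Lau)⁻¹) * c L) := by
    intro L hL
    rw [← Finset.sum_mul]
    congr 1
    rw [mem_partsOf, Nat.cast_inj] at hL
    rw [← hL, msum, Finset.sum_multiset_map_count]
    simp only [smul_eq_mul, Nat.cast_sum, Nat.cast_mul]
  rw [Finset.mul_sum, Finset.sum_congr rfl h1, Finset.sum_sigma']
  simp only [Finset.mul_sum]
  rw [Finset.sum_sigma']
  refine Finset.sum_nbij' (fun x => ⟨x.2.natPred, x.1.erase x.2⟩)
    (fun x => ⟨x.1.succPNat ::ₘ x.2, x.1.succPNat⟩) ?_ ?_ ?_ ?_ ?_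
  · rintro ⟨L, a⟩ h
    simp only [Finset.mem_sigma, Multiset.mem_toFinset, mem_partsOf, Finset.mem_range] at h ⊢
    have h2 := msum_cons a (L.erase a)
    rw [Multiset.cons_erase h.2] at h2
    have h3 := PNat.natPred_add_one a
    omega
  · rintro ⟨l, L⟩ h
    simp only [Finset.mem_sigma, Multiset.mem_toFinset, mem_partsOf, Finset.mem_range] at h ⊢
    refine ⟨?_, Multiset.mem_cons_self _ _⟩
    rw [msum_cons, Nat.succPNat_coe]
    omega
  · rintro ⟨L, a⟩ h
    simp only [Finset.mem_sigma, Multiset.mem_toFinset] at h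
    simp only [PNat.succPNat_natPred, Multiset.cons_erase h.2]
  · rintro ⟨l, L⟩ h
    simp
  · rintro ⟨L, a⟩ h
    simp only [Finset.mem_sigma, Multiset.mem_toFinset] at h
    obtain ⟨L, rfl⟩ := Multiset.exists_cons_of_mem h.2
    have h2 : ((a ::ₘ L).count a : Lau) ≠ 0 := by
      rw [Multiset.count_cons_self]
      exact Nat.cast_ne_zero.2 (Nat.succ_ne_zero _)
    have h3 : ((a : ℕ) : Lau) ≠ 0 := by exact_mod_cast a.pos.ne'
    have h4 : ((a.natPred + 1 : ℕ) : ℂ) = (a : ℂ) := by rw [PNat.natPred_add_one]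
    simp only [PNat.succPNat_natPred, Multiset.erase_cons_head, h4]
    rw [multFact_cons, sinhProd_cons, mprod_cons, Nat.cast_mul, Nat.cast_mul]
    generalize c (a ::ₘ L) = x
    generalize sinhProd L = y
    generalize ((a ::ₘ L).count a : Lau) = z at *
    generalize ((a : ℕ) : Lau) = w at *
    rw [mul_inv, mul_inv]
    field_simp

/-! ### Expansion of the matrix elements -/

/-- The covector `f ∘ α_a`. -/
noncomputable def compAlpha (a : ℕ+) (f : Module.Dual ℂ Fock) : Module.Dual ℂ Fock :=
  f ∘ₗ alpha a

/-- The α's of positive index commute, so ⟨0|α_M depends only on the multiset M. -/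
instance : LeftCommutative compAlpha where
  left_comm a b f := LinearMap.ext fun v => by
    have ha := a.pos
    have hb := b.pos
    change f (alpha b (alpha a v)) = f (alpha a (alpha b v))
    rw [alpha_comm (by omega)]

/-- The covector `⟨0| ∏ α_a`. -/
noncomputable def vacAlpha (M : Multiset ℕ+) : Module.Dual ℂ Fock := M.foldr compAlpha vac

lemma vacAlpha_cons (a : ℕ+) (M : Multiset ℕ+) (v : Fock) :
    vacAlpha (a ::ₘ M) v = vacAlpha M (alpha a v) := by
  rw [vacAlpha, Multiset.foldr_cons]
  rfl

lemma vacAlpha_coe (l : List ℕ+) (v : Fock) :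
    vacAlpha l v = vac ((l.map fun a : ℕ+ => alpha (a : ℤ)).prod v) := by
  induction l using List.reverseRecOn generalizing v with
  | nil => rfl
  | append_singleton l a ih =>
    rw [← Multiset.coe_add, add_comm, Multiset.coe_singleton, Multiset.singleton_add,
      vacAlpha_cons, ih]
    simp

/-- Bosonic expansion of ⟨0|𝓔_N(z). Both sides satisfy the same recursion, which determines them
because N is invertible in ℂ((z)). -/
lemma matEC_vac_eq_sum (N : ℤ) (v : Fock) : matEC N vac v =
    ∑ L ∈ partsOf N, (multFact L : Lau)⁻¹ * (sinhProd L * (mprod L : Lau)⁻¹) *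
      (HahnSeries.C (vacAlpha L v) * (sinhL 1)⁻¹) := by
  rcases lt_or_ge N 0 with h | h
  · rw [matEC_vac_of_neg h, Finset.sum_eq_zero]
    intro L hL
    rw [mem_partsOf] at hL
    omega
  · lift N to ℕ using h
    induction N using Nat.strong_induction_on generalizing v with
    | _ N ih =>
      rcases N with _ | M
      · have : partsOf (0 : ℕ) = {0} := by
          ext L
          rw [mem_partsOf, Nat.cast_inj, msum_eq_zero, Finset.mem_singleton]
        rw [this, Finset.sum_singleton, Nat.cast_zero, matEC_vac_zero]
        simp [multFact_zero, sinhProd, mprod, vacAlpha]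
      · have h0 : ((M + 1 : ℕ) : Lau) ≠ 0 :=
          Nat.cast_ne_zero.2 (Nat.succ_ne_zero _)
        refine mul_left_cancel₀ h0 ?_
        rw [matEC_vac_recursion, sum_partsOf_recursion]
        refine Finset.sum_congr rfl fun l hl => ?_
        rw [Finset.mem_range] at hl
        rw [ih (M - l) (by omega)]
        congr 1
        refine Finset.sum_congr ?_ fun L _ => ?_
        · congr 1
          omega
        · rw [vacAlpha_cons, Nat.succPNat_coe]

/-- Each α_a either passes through 𝓔 or is absorbed with a factor ς(az). The antidiagonal records
the absorbed part and the rest; the vacuum expansion then applies to the shifted 𝓔. -/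
lemma matEC_vacAlpha (M : Multiset ℕ+) (n : ℤ) (v : Fock) : matEC n (vacAlpha M) v =
    (M.antidiagonal.map fun x => sinhProd x.1 * ∑ L ∈ partsOf (n + msum x.1),
      (multFact L : Lau)⁻¹ * (sinhProd L * (mprod L : Lau)⁻¹) *
        (HahnSeries.C (vacAlpha (x.2 + L) v) * (sinhL 1)⁻¹)).sum := by
  induction M using Multiset.induction_on generalizing n v with
  | empty =>
    change matEC n vac v = _
    rw [matEC_vac_eq_sum]
    simp [sinhProd, msum]
  | cons a M ih =>
    have h : vacAlpha (a ::ₘ M) = vacAlpha M ∘ₗ alpha a := LinearMap.ext fun v => vacAlpha_cons a M v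
    rw [h, matEC_comp_alpha, ih, ih, Multiset.antidiagonal_cons, Multiset.map_add,
      Multiset.sum_add, Multiset.map_map, Multiset.map_map, ← Multiset.sum_map_mul_left]
    refine congrArg₂ (· + ·) (congrArg Multiset.sum (Multiset.map_congr rfl fun x _ => ?_))
      (congrArg Multiset.sum (Multiset.map_congr rfl fun x _ => ?_))
    · simp only [Function.comp_apply, Prod.map_fst, Prod.map_snd, id, Multiset.cons_add,
        vacAlpha_cons]
    · simp only [Function.comp_apply, Prod.map_fst, Prod.map_snd, id, sinhProd_cons, msum_cons]
      rw [mul_assoc]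
      push_cast
      rw [add_assoc]

/-! ### Coefficients of the cut-and-join formula -/

/-- `[z^d] ς(z)⁻¹ ∏ ς(az) ∏ ς(bz)`. -/
noncomputable def sinhCoeffM (d : ℕ) (I L : Multiset ℕ+) : ℂ :=
  ((sinhL 1)⁻¹ * sinhProd I * sinhProd L).coeff (d : ℤ)

lemma sinhCoeff_eq (d : ℕ) (κ l : List ℕ+) : sinhCoeff d κ l = sinhCoeffM d κ l := by
  unfold sinhCoeff sinhCoeffM sinhProd
  simp only [coe_rescale_sinhSer, coe_sinhSer, Multiset.map_coe, Multiset.prod_coe]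

/-- The pairs of multisets `(I, L)` with `I ≤ M` and `∑ I = ∑ L + k`, not both empty. -/
noncomputable def cutJoinPairs (k : ℕ) (M : Multiset ℕ+) : Finset (Multiset ℕ+ × Multiset ℕ+) :=
  ((Finset.Icc 0 M).biUnion fun I => (partsOf (-(k : ℤ) + msum I)).image fun L => (I, L)).erase
    (0, 0)

lemma mem_biUnion_pairs {k : ℕ} {M : Multiset ℕ+} {x : Multiset ℕ+ × Multiset ℕ+} :
    x ∈ ((Finset.Icc 0 M).biUnion fun I => (partsOf (-(k : ℤ) + msum I)).image fun L => (I, L)) ↔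
      x.1 ∈ Finset.Icc 0 M ∧ x.2 ∈ partsOf (-(k : ℤ) + msum x.1) := by
  obtain ⟨I, L⟩ := x
  simp only [Finset.mem_biUnion, Finset.mem_image, Prod.mk.injEq]
  constructor
  · rintro ⟨I', h1, L', h2, rfl, rfl⟩
    exact ⟨h1, h2⟩
  · rintro ⟨h1, h2⟩
    exact ⟨I, h1, L, h2, rfl, rfl⟩

lemma mem_cutJoinPairs {k : ℕ} {M : Multiset ℕ+} {x : Multiset ℕ+ × Multiset ℕ+} :
    x ∈ cutJoinPairs k M ↔ ¬(x.1 = 0 ∧ x.2 = 0) ∧ x.1 ≤ M ∧ msum x.1 = msum x.2 + k := by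
  rw [cutJoinPairs, Finset.mem_erase, mem_biUnion_pairs, Finset.mem_Icc, mem_partsOf, Ne,
    Prod.ext_iff]
  have : (0 : Multiset ℕ+) ≤ x.1 := Multiset.zero_le _
  have h : (msum x.2 : ℤ) = -(k : ℤ) + msum x.1 ↔ msum x.1 = msum x.2 + k := by omega
  rw [h]
  tauto

lemma natCast_inv_eq_C (n : ℕ) : ((n : Lau))⁻¹ = HahnSeries.C ((n : ℂ)⁻¹) := by
  rw [map_inv₀, map_natCast]

lemma matEC_neg_vacAlpha (k : ℕ) (M : Multiset ℕ+) (v : Fock) :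
    matEC (-(k : ℤ)) (vacAlpha M) v = ∑ I ∈ Finset.Icc 0 M, ∑ L ∈ partsOf (-(k : ℤ) + msum I),
      HahnSeries.C ((multFact M : ℂ) * ((multFact I : ℂ)⁻¹ * (multFact (M - I) : ℂ)⁻¹ *
        (multFact L : ℂ)⁻¹ * (mprod L : ℂ)⁻¹ * vacAlpha (M - I + L) v)) *
          ((sinhL 1)⁻¹ * sinhProd I * sinhProd L) := by
  rw [matEC_vacAlpha, sum_antidiagonal_eq M fun I J => sinhProd I *
    ∑ L ∈ partsOf (-(k : ℤ) + msum I),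
      (multFact L : Lau)⁻¹ * (sinhProd L * (mprod L : Lau)⁻¹) *
        (HahnSeries.C (vacAlpha (J + L) v) * (sinhL 1)⁻¹), Finset.mul_sum]
  refine Finset.sum_congr rfl fun I _ => ?_
  rw [Finset.mul_sum, Finset.mul_sum, Finset.mul_sum]
  refine Finset.sum_congr rfl fun L _ => ?_
  simp only [map_mul, ← natCast_inv_eq_C, map_natCast]
  ring

/-- The cut-and-join formula for covectors. The pair (0, 0) occurs in the expansion only for k = 0,
where it is the scalar 1/ς(z) separating 𝓔_0 from 𝓔̃_0; this is why both tuples may not be empty in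
the cut-and-join operator. -/
lemma vacAlpha_calE (k d : ℕ) (M : Multiset ℕ+) (v : Fock) :
    vacAlpha M (PowerSeries.coeff d (calE (-(k : ℤ))) v) =
      (multFact M : ℂ) * ∑ x ∈ cutJoinPairs k M, (multFact x.1 : ℂ)⁻¹ * (multFact x.2 : ℂ)⁻¹ *
        ((multFact (M - x.1) : ℂ)⁻¹ * (mprod x.2 : ℂ)⁻¹ * vacAlpha (M - x.1 + x.2) v *
          sinhCoeffM d x.1 x.2) := by
  have heq : matEC (-(k : ℤ)) (vacAlpha M) v = ∑ x ∈ (Finset.Icc 0 M).biUnion fun I =>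
      (partsOf (-(k : ℤ) + msum I)).image fun L => (I, L),
        HahnSeries.C ((multFact M : ℂ) * ((multFact x.1 : ℂ)⁻¹ *
          (multFact (M - x.1) : ℂ)⁻¹ * (multFact x.2 : ℂ)⁻¹ * (mprod x.2 : ℂ)⁻¹ *
            vacAlpha (M - x.1 + x.2) v)) * ((sinhL 1)⁻¹ * sinhProd x.1 * sinhProd x.2) := by
    rw [Finset.sum_finset_product _ (Finset.Icc 0 M) (fun I => partsOf (-(k : ℤ) + msum I))
      fun x => mem_biUnion_pairs]
    exact matEC_neg_vacAlpha k M v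
  have h := congrArg (fun x : Lau => x.coeff (d : ℤ)) heq
  simp only [matEC, HahnSeries.coeff_add, coeff_matE, HahnSeries.coeff_sum,
    HahnSeries.C_mul_eq_smul, HahnSeries.coeff_smul, smul_eq_mul] at h
  have h1 : (multFact M : ℂ) ≠ 0 := by exact_mod_cast (multFact_pos M).ne'
  have h2 : (if -(k : ℤ) = 0 then vacAlpha M v • (sinhL 1)⁻¹ else 0 : Lau).coeff (d : ℤ) =
      if k = 0 then vacAlpha M v * sinhCoeffM d 0 0 else 0 := by
    by_cases hk : k = 0
    · rw [if_pos (by omega), if_pos hk, HahnSeries.coeff_smul, smul_eq_mul, sinhCoeffM]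
      simp [sinhProd]
    · rw [if_neg (by omega), if_neg hk, HahnSeries.coeff_zero]
  rw [h2] at h
  by_cases hk : k = 0
  · have h0 : ((0 : Multiset ℕ+), (0 : Multiset ℕ+)) ∈ (Finset.Icc 0 M).biUnion fun I =>
        (partsOf (-(k : ℤ) + msum I)).image fun L => (I, L) := by
      rw [mem_biUnion_pairs, mem_partsOf, Finset.mem_Icc]
      simp [hk, msum]
    rw [← Finset.add_sum_erase _ _ h0, if_pos hk, add_comm] at h
    -- The pair (0, 0) contributes ⟨0|α_M v⟩/ς(z), the same scalar that `matEC` adds to `matE`.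
    have h3 : (multFact M : ℂ) * ((multFact (0 : Multiset ℕ+) : ℂ)⁻¹ *
        (multFact (M - 0) : ℂ)⁻¹ * (multFact (0 : Multiset ℕ+) : ℂ)⁻¹ *
          (mprod 0 : ℂ)⁻¹ * vacAlpha (M - 0 + 0) v) = vacAlpha M v := by
      rw [tsub_zero, add_zero, multFact_zero]
      simp only [mprod, Multiset.map_zero, Multiset.prod_zero, Nat.cast_one]
      field_simp
    simp only [h3] at h
    rw [add_left_cancel h, Finset.mul_sum]
    refine Finset.sum_congr rfl fun x _ => ?_
    rw [sinhCoeffM]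
    ring
  · have h0 : ((0 : Multiset ℕ+), (0 : Multiset ℕ+)) ∉ (Finset.Icc 0 M).biUnion fun I =>
        (partsOf (-(k : ℤ) + msum I)).image fun L => (I, L) := by
      rw [mem_biUnion_pairs, mem_partsOf]
      rintro ⟨-, h⟩
      simp only [msum, Multiset.map_zero, Multiset.sum_zero] at h
      omega
    rw [if_neg hk, add_zero] at h
    rw [h, cutJoinPairs, Finset.erase_eq_of_notMem h0, Finset.mul_sum]
    refine Finset.sum_congr rfl fun x _ => ?_
    rw [sinhCoeffM]
    ring

/-! ### Exponents -/

/-- The exponent of the monomial `∏ v(a)` over a multiset. -/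
noncomputable def mexpo (v : ℕ+ → Var) (M : Multiset ℕ+) : Var →₀ ℕ :=
  (M.map fun a : ℕ+ => Finsupp.single (v a) 1).sum

/-- The exponent of `β^s p_M q_N`. -/
noncomputable def vexp (s : ℕ) (M N : Multiset ℕ+) : Var →₀ ℕ :=
  Finsupp.single Var.beta s + mexpo Var.p M + mexpo Var.q N

lemma expo_eq_mexpo (v : ℕ+ → Var) (l : List ℕ+) : expo v l = mexpo v l := rfl

lemma mexpo_cons (v : ℕ+ → Var) (a : ℕ+) (M : Multiset ℕ+) :
    mexpo v (a ::ₘ M) = Finsupp.single (v a) 1 + mexpo v M := by simp [mexpo]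

lemma mexpo_add (v : ℕ+ → Var) (M N : Multiset ℕ+) :
    mexpo v (M + N) = mexpo v M + mexpo v N := by simp [mexpo]

lemma mexpo_apply_self {v : ℕ+ → Var} (hv : Function.Injective v) (M : Multiset ℕ+) (a : ℕ+) :
    mexpo v M (v a) = M.count a := by
  classical
  induction M using Multiset.induction_on with
  | empty => simp [mexpo]
  | cons b M ih =>
    rw [mexpo_cons, Finsupp.add_apply, ih, Finsupp.single_apply, Multiset.count_cons, add_comm]
    congr 1
    simp only [hv.eq_iff, eq_comm]

lemma mexpo_apply_of_ne {v : ℕ+ → Var} {x : Var} (h : ∀ a, v a ≠ x) (M : Multiset ℕ+) :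
    mexpo v M x = 0 := by
  classical
  induction M using Multiset.induction_on with
  | empty => simp [mexpo]
  | cons b M ih => rw [mexpo_cons, Finsupp.add_apply, ih, Finsupp.single_apply, if_neg (h b)]

lemma var_p_injective : Function.Injective Var.p := fun _ _ h => by cases h; rfl

lemma var_q_injective : Function.Injective Var.q := fun _ _ h => by cases h; rfl

lemma vexp_beta (s : ℕ) (M N : Multiset ℕ+) : vexp s M N Var.beta = s := by
  simp [vexp, mexpo_apply_of_ne]

lemma vexp_p (s : ℕ) (M N : Multiset ℕ+) (a : ℕ+) : vexp s M N (Var.p a) = M.count a := by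
  simp [vexp, mexpo_apply_of_ne, mexpo_apply_self var_p_injective]

lemma vexp_q (s : ℕ) (M N : Multiset ℕ+) (a : ℕ+) : vexp s M N (Var.q a) = N.count a := by
  simp [vexp, mexpo_apply_of_ne, mexpo_apply_self var_q_injective]

lemma vexp_injective {s s' : ℕ} {M M' N N' : Multiset ℕ+} (h : vexp s M N = vexp s' M' N') :
    s = s' ∧ M = M' ∧ N = N' := by
  refine ⟨?_, Multiset.ext' fun a => ?_, Multiset.ext' fun a => ?_⟩
  · rw [← vexp_beta s M N, h, vexp_beta]
  · rw [← vexp_p s M N, h, vexp_p]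
  · rw [← vexp_q s M N, h, vexp_q]

lemma exists_vexp_eq (e : Var →₀ ℕ) : ∃ s M N, e = vexp s M N := by
  refine ⟨e Var.beta, Finsupp.toMultiset (e.comapDomain Var.p var_p_injective.injOn),
    Finsupp.toMultiset (e.comapDomain Var.q var_q_injective.injOn), ?_⟩
  ext x
  rcases x with _ | a | a
  · rw [vexp_beta]
  · rw [vexp_p, Finsupp.count_toMultiset, Finsupp.comapDomain_apply]
  · rw [vexp_q, Finsupp.count_toMultiset, Finsupp.comapDomain_apply]

lemma mexpo_le_vexp {s : ℕ} {I M N : Multiset ℕ+} : mexpo Var.p I ≤ vexp s M N ↔ I ≤ M := by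
  constructor
  · intro h
    rw [Multiset.le_iff_count]
    intro a
    have := h (Var.p a)
    rwa [vexp_p, mexpo_apply_self var_p_injective] at this
  · intro h x
    rcases x with _ | a | a
    · rw [mexpo_apply_of_ne (by simp)]
      exact Nat.zero_le _
    · rw [vexp_p, mexpo_apply_self var_p_injective]
      exact Multiset.le_iff_count.1 h a
    · rw [mexpo_apply_of_ne (by simp)]
      exact Nat.zero_le _

lemma vexp_sub {s : ℕ} {I M N : Multiset ℕ+} (h : I ≤ M) :
    vexp s M N - mexpo Var.p I = vexp s (M - I) N := by
  have : vexp s M N = vexp s (M - I) N + mexpo Var.p I := by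
    conv_lhs => rw [← tsub_add_cancel_of_le h]
    simp only [vexp, mexpo_add]
    abel
  rw [this, add_tsub_cancel_right]

lemma vexp_add_p (s : ℕ) (M N : Multiset ℕ+) (a : ℕ+) :
    vexp s M N + Finsupp.single (Var.p a) 1 = vexp s (a ::ₘ M) N := by
  simp only [vexp, mexpo_cons]
  abel

lemma vexp_add_beta (s : ℕ) (M N : Multiset ℕ+) :
    vexp s M N + Finsupp.single Var.beta 1 = vexp (s + 1) M N := by
  simp only [vexp, Finsupp.single_add]
  abel

/-- Successive derivatives produce a ratio of products of factorials, which later cancels the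
1/|Aut| of the generating series. -/
lemma coeff_pderiv_list (l : List ℕ+) (F : Ser) (s : ℕ) (J N : Multiset ℕ+) :
    MvPowerSeries.coeff (vexp s J N)
      ((l.map fun b : ℕ+ => ((MvPowerSeries.pderiv ℂ (Var.p b) : Derivation ℂ Ser Ser) :
        Module.End ℂ Ser)).prod F) =
      (multFact (J + (l : Multiset ℕ+)) : ℂ) * (multFact J : ℂ)⁻¹ *
        MvPowerSeries.coeff (vexp s (J + l) N) F := by
  induction l generalizing J with
  | nil =>
    have : (multFact J : ℂ) ≠ 0 := by exact_mod_cast (multFact_pos J).ne'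
    simp [this]
  | cons b l ih =>
    rw [List.map_cons, List.prod_cons, Module.End.mul_apply]
    refine (MvPowerSeries.coeff_pderiv _ _).trans ?_
    have h1 : (multFact J : ℂ) ≠ 0 := by exact_mod_cast (multFact_pos J).ne'
    have h2 : ((J.count b : ℂ) + 1) ≠ 0 := by exact_mod_cast Nat.succ_ne_zero (J.count b)
    have h3 : b ::ₘ J + (l : Multiset ℕ+) = J + ((b :: l : List ℕ+) : Multiset ℕ+) := by
      rw [← Multiset.cons_coe, Multiset.cons_add, Multiset.add_cons]
    rw [vexp_add_p, ih, vexp_p, h3, multFact_cons, Multiset.count_cons_self]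
    push_cast
    field_simp

/-! ### The generating series -/

/-- The vector `(s! ∏ N)⁻¹ ∑_ν (1/n!) 𝓔^s ∏ α_{-ν_j} |0⟩`, the sum over the orderings `ν` of `N`,
where `𝓔` is the `z^d` coefficient of `𝓔_{-k}(z)`. -/
noncomputable def stateVec (k d s : ℕ) (N : Multiset ℕ+) : Fock :=
  ∑ ν ∈ listsOf N, ((ν.length.factorial : ℂ)⁻¹ * ((s.factorial : ℂ)⁻¹ * (mprod N : ℂ)⁻¹)) •
    (PowerSeries.coeff d (calE (-(k : ℤ))) ^ s)
      ((ν.map fun m : ℕ+ => alpha (-(m : ℤ))).prod (Finsupp.single Maya.vacuum 1))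

/-- The factor s + 1 comes from 1/s! and matches the one produced by ∂/∂β. -/
lemma calE_stateVec (k d s : ℕ) (N : Multiset ℕ+) :
    PowerSeries.coeff d (calE (-(k : ℤ))) (stateVec k d s N) =
      ((s : ℂ) + 1) • stateVec k d (s + 1) N := by
  rw [stateVec, stateVec, map_sum, Finset.smul_sum]
  refine Finset.sum_congr rfl fun ν _ => ?_
  have h1 : ((s : ℂ) + 1) ≠ 0 := by exact_mod_cast Nat.succ_ne_zero s
  rw [map_smul, smul_smul, pow_succ', Module.End.mul_apply, Nat.factorial_succ]
  congr 1
  push_cast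
  field_simp

lemma vac_calE_of_nonpos {n : ℤ} (hn : n ≤ 0) (d : ℕ) (v : Fock) :
    vac (PowerSeries.coeff d (calE n) v) = 0 := by
  rw [← coeff_matE, matE_vac_of_nonpos hn, HahnSeries.coeff_zero]

/-- The leftmost operator is 𝓔_{-k} or some α_{-ν_j}, each of nonpositive index and hence killed by
⟨0|. -/
lemma vac_stateVec (k d s : ℕ) {N : Multiset ℕ+} (hN : N ≠ 0) : vac (stateVec k d s N) = 0 := by
  rw [stateVec, map_sum]
  refine Finset.sum_eq_zero fun ν hν => ?_
  rw [map_smul]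
  refine smul_eq_zero_of_right _ ?_
  rcases s with _ | s
  · rcases ν with _ | ⟨a, ν⟩
    · exact absurd (mem_listsOf.1 hν).symm hN
    · rw [pow_zero, Module.End.one_apply, List.map_cons, List.prod_cons, Module.End.mul_apply, alpha,
        ← PowerSeries.coeff_zero_eq_constantCoeff_apply]
      exact vac_calE_of_nonpos (by omega) 0 _
  · rw [pow_succ', Module.End.mul_apply]
    exact vac_calE_of_nonpos (by omega) d _

lemma partProd_eq (l : List ℕ+) : partProd l = (mprod l : ℂ) := by
  simp [partProd, mprod, Nat.cast_list_prod, List.map_map, Function.comp_def]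

lemma hurwitz_eq (k d s : ℕ) (μ ν : List ℕ+) : hurwitz k d s μ ν =
    ((mprod μ : ℂ) * (mprod ν : ℂ))⁻¹ * vacAlpha μ
      ((PowerSeries.coeff d (calE (-(k : ℤ))) ^ s)
        ((ν.map fun m : ℕ+ => alpha (-(m : ℤ))).prod (Finsupp.single Maya.vacuum 1))) := by
  rw [hurwitz, partProd_eq, partProd_eq, vacAlpha_coe]
  congr 1
  change vev _ = _
  rw [vev]
  simp only [Finsupp.equivFunOnFinite_symm_apply_apply, List.ofFn_const, List.prod_replicate]
  rfl

lemma coeff_genTerm (k : ℤ) (d s s' : ℕ) (μ ν : List ℕ+) (M N : Multiset ℕ+) :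
    MvPowerSeries.coeff (vexp s M N) (genTerm k d s' μ ν) =
      if s' = s ∧ (μ : Multiset ℕ+) = M ∧ (ν : Multiset ℕ+) = N then
        hurwitz k d s' μ ν / ((s'.factorial : ℂ) * μ.length.factorial * ν.length.factorial)
      else 0 := by
  classical
  simp only [genTerm, prod_X_eq, MvPowerSeries.coeff_smul, MvPowerSeries.X_pow_eq,
    MvPowerSeries.monomial_mul_monomial, MvPowerSeries.coeff_monomial, mul_one]
  by_cases h : s' = s ∧ (μ : Multiset ℕ+) = M ∧ (ν : Multiset ℕ+) = N
  · obtain ⟨rfl, rfl, rfl⟩ := h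
    have e : vexp s' μ ν = Finsupp.single Var.beta s' + expo Var.p μ + expo Var.q ν := rfl
    rw [if_pos e, if_pos ⟨rfl, rfl, rfl⟩, mul_one]
  · rw [if_neg h, if_neg, mul_zero]
    intro h'
    obtain ⟨h1, h2, h3⟩ := vexp_injective (s := s) (M := M) (N := N) (s' := s') (M' := μ) (N' := ν) h'
    exact h ⟨h1.symm, h2.symm, h3.symm⟩

/-- The restriction n ≥ 1 gives the zero at N = 0. The restriction m ≥ 1 needs no case, since
⟨0|w_s⟩ already vanishes for N nonempty. -/
lemma coeff_genSeries (k d s : ℕ) (M N : Multiset ℕ+) :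
    MvPowerSeries.coeff (vexp s M N) (genSeries (k : ℤ) d) = if N = 0 then 0 else
      (multFact M : ℂ)⁻¹ * (mprod M : ℂ)⁻¹ * vacAlpha M (stateVec k d s N) := by
  classical
  have h1 : MvPowerSeries.coeff (vexp s M N) (genSeries (k : ℤ) d) =
      ∑ μ ∈ (listsOf M).subtype (· ≠ []), ∑ ν ∈ (listsOf N).subtype (· ≠ []),
        hurwitz k d s μ.1 ν.1 /
          ((s.factorial : ℂ) * μ.1.length.factorial * ν.1.length.factorial) := by
    change (∑ᶠ x : ℕ × {μ : List ℕ+ // μ ≠ []} × {ν : List ℕ+ // ν ≠ []},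
      MvPowerSeries.coeff (vexp s M N) (genTerm k d x.1 x.2.1 x.2.2)) = _
    rw [finsum_eq_sum_of_support_subset (s := {s} ×ˢ ((listsOf M).subtype (· ≠ []) ×ˢ
      (listsOf N).subtype (· ≠ []))), Finset.sum_product, Finset.sum_singleton, Finset.sum_product]
    · refine Finset.sum_congr rfl fun μ hμ => Finset.sum_congr rfl fun ν hν => ?_
      rw [Finset.mem_subtype, mem_listsOf] at hμ hν
      rw [coeff_genTerm, if_pos ⟨rfl, hμ, hν⟩]
    · rintro ⟨s', μ, ν⟩ hx
      rw [Function.mem_support, coeff_genTerm] at hx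
      have h := not_not.1 fun h => hx (if_neg h)
      simp only [Finset.coe_product, Set.mem_prod, Finset.mem_coe, Finset.mem_singleton,
        Finset.mem_subtype, mem_listsOf]
      exact h
  have hempty : (listsOf (0 : Multiset ℕ+)).subtype (· ≠ []) = ∅ := by
    ext l
    simp only [Finset.mem_subtype, mem_listsOf, Multiset.coe_eq_zero, Finset.notMem_empty,
      iff_false]
    exact l.2
  have hsub : ∀ {L : Multiset ℕ+}, L ≠ 0 → ∀ l ∈ listsOf L, l ≠ [] := by
    rintro L hL l hl rfl
    exact hL (mem_listsOf.1 hl).symm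
  rw [h1]
  by_cases hN : N = 0
  · subst hN
    rw [if_pos rfl, hempty]
    simp
  rw [if_neg hN]
  by_cases hM : M = 0
  · subst hM
    have : vacAlpha 0 (stateVec k d s N) = 0 := vac_stateVec k d s hN
    rw [hempty, Finset.sum_empty, this, mul_zero]
  rw [Finset.sum_subtype_of_mem (fun μ : List ℕ+ => ∑ ν ∈ (listsOf N).subtype (· ≠ []),
    hurwitz k d s μ ν.1 / ((s.factorial : ℂ) * μ.length.factorial * ν.1.length.factorial))
    (hsub hM), mul_assoc, ← sum_listsOf]
  refine Finset.sum_congr rfl fun μ hμ => ?_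
  rw [mem_listsOf] at hμ
  rw [Finset.sum_subtype_of_mem (fun ν : List ℕ+ =>
    hurwitz k d s μ ν / ((s.factorial : ℂ) * μ.length.factorial * ν.length.factorial))
    (hsub hN), stateVec, map_sum, Finset.mul_sum, Finset.mul_sum]
  refine Finset.sum_congr rfl fun ν hν => ?_
  rw [mem_listsOf] at hν
  rw [hurwitz_eq, map_smul, hμ, hν, smul_eq_mul, div_eq_mul_inv, mul_inv, mul_inv, mul_inv]
  ring

lemma coeff_cutJoinTerm (k d s : ℕ) (κ l : List ℕ+) (M : Multiset ℕ+) {N : Multiset ℕ+}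
    (hN : N ≠ 0) : MvPowerSeries.coeff (vexp s M N) (cutJoinTerm d κ l (genSeries (k : ℤ) d)) =
      if (κ : Multiset ℕ+) ≤ M then (κ.length.factorial : ℂ)⁻¹ * ((l.length.factorial : ℂ)⁻¹ *
        ((mprod M : ℂ)⁻¹ * ((multFact (M - (κ : Multiset ℕ+)) : ℂ)⁻¹ * (mprod l : ℂ)⁻¹ *
          vacAlpha (M - κ + l) (stateVec k d s N) * sinhCoeffM d κ l)))
      else 0 := by
  rw [cutJoinTerm, prod_X_eq, MvPowerSeries.coeff_smul, MvPowerSeries.coeff_monomial_mul,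
    expo_eq_mexpo]
  by_cases h : (κ : Multiset ℕ+) ≤ M
  · have h1 : (multFact (M - (κ : Multiset ℕ+) + (l : Multiset ℕ+)) : ℂ) ≠ 0 := by exact_mod_cast (multFact_pos _).ne'
    -- The 1/∏κ_i of the operator and the 1/∏ of the remaining parts combine to 1/∏M, leaving 1/∏ℓ_j
    -- as in `vacAlpha_calE`.
    have h2 : (mprod M : ℂ) = mprod κ * mprod (M - (κ : Multiset ℕ+)) := by
      rw [← Nat.cast_mul, ← mprod_add, add_tsub_cancel_of_le h]
    rw [if_pos (mexpo_le_vexp.2 h), if_pos h, vexp_sub h, coeff_pderiv_list, coeff_genSeries, if_neg hN,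
      sinhCoeff_eq, partProd_eq, mprod_add, h2, div_eq_mul_inv, one_mul]
    push_cast
    simp only [mul_inv]
    field_simp
  · rw [if_neg fun h' => h (mexpo_le_vexp.1 h'), if_neg h, mul_zero]

lemma coeff_cutJoin (k d s : ℕ) (M : Multiset ℕ+) {N : Multiset ℕ+} (hN : N ≠ 0) :
    MvPowerSeries.coeff (vexp s M N) (cutJoin k d (genSeries (k : ℤ) d)) =
      ∑ x ∈ cutJoinPairs k M, (multFact x.1 : ℂ)⁻¹ * ((multFact x.2 : ℂ)⁻¹ *
        ((mprod M : ℂ)⁻¹ * ((multFact (M - x.1) : ℂ)⁻¹ * (mprod x.2 : ℂ)⁻¹ *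
          vacAlpha (M - x.1 + x.2) (stateVec k d s N) * sinhCoeffM d x.1 x.2))) := by
  classical
  set T : Finset (List ℕ+ × List ℕ+) :=
    (cutJoinPairs k M).biUnion fun x => listsOf x.1 ×ˢ listsOf x.2 with hT
  have hmem : ∀ x : List ℕ+ × List ℕ+, x ∈ T ↔
      ((x.1 : Multiset ℕ+), (x.2 : Multiset ℕ+)) ∈ cutJoinPairs k M := by
    rintro ⟨κ, l⟩
    simp only [hT, Finset.mem_biUnion, Finset.mem_product, mem_listsOf]
    constructor
    · rintro ⟨⟨I, L⟩, hx, rfl, rfl⟩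
      exact hx
    · intro hx
      exact ⟨_, hx, rfl, rfl⟩
  change (∑ᶠ x : {x : List ℕ+ × List ℕ+ //
      ¬(x.1 = [] ∧ x.2 = []) ∧ partSum x.1 = partSum x.2 + k},
    MvPowerSeries.coeff (vexp s M N) (cutJoinTerm d x.1.1 x.1.2 (genSeries (k : ℤ) d))) = _
  rw [finsum_eq_sum_of_support_subset (s := T.subtype _), Finset.sum_subtype_of_mem
    (fun x : List ℕ+ × List ℕ+ =>
      MvPowerSeries.coeff (vexp s M N) (cutJoinTerm d x.1 x.2 (genSeries (k : ℤ) d))), hT,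
    Finset.sum_biUnion]
  · refine Finset.sum_congr rfl fun x hx => ?_
    rw [mem_cutJoinPairs] at hx
    rw [Finset.sum_product, ← sum_listsOf]
    refine Finset.sum_congr rfl fun κ hκ => ?_
    rw [← sum_listsOf, Finset.mul_sum]
    refine Finset.sum_congr rfl fun l hl => ?_
    rw [mem_listsOf] at hκ hl
    rw [coeff_cutJoinTerm k d s κ l M hN, hκ, hl, if_pos hx.2.1]
  · intro x _ y _ hxy
    rw [Function.onFun_apply, Finset.disjoint_left]
    rintro ⟨κ, l⟩ h1 h2
    rw [Finset.mem_product, mem_listsOf, mem_listsOf] at h1 h2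
    exact hxy (Prod.ext (h1.1.symm.trans h2.1) (h1.2.symm.trans h2.2))
  · intro x hx
    rw [hmem, mem_cutJoinPairs] at hx
    simpa only [Multiset.coe_eq_zero, msum_coe] using And.intro hx.1 hx.2.2
  · rintro ⟨⟨κ, l⟩, h⟩ hx
    rw [Function.mem_support, coeff_cutJoinTerm k d s κ l M hN] at hx
    have hle := not_not.1 fun h => hx (if_neg h)
    rw [Finset.mem_coe, Finset.mem_subtype, hmem, mem_cutJoinPairs]
    simpa only [Multiset.coe_eq_zero, msum_coe] using And.intro h.1 (And.intro hle h.2)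

/-- The operator does not touch the q variables, so it cannot create terms free of q. -/
lemma coeff_cutJoin_zero (k d s : ℕ) (M : Multiset ℕ+) :
    MvPowerSeries.coeff (vexp s M 0) (cutJoin k d (genSeries (k : ℤ) d)) = 0 := by
  refine finsum_eq_zero_of_forall_eq_zero fun x => ?_
  change MvPowerSeries.coeff _ (cutJoinTerm d x.1.1 x.1.2 _) = 0
  rw [cutJoinTerm, prod_X_eq, MvPowerSeries.coeff_smul, MvPowerSeries.coeff_monomial_mul,
    expo_eq_mexpo]
  split_ifs with h
  · rw [vexp_sub (mexpo_le_vexp.1 h), coeff_pderiv_list, coeff_genSeries, if_pos rfl]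
    simp only [mul_zero]
  · rw [mul_zero]

end LeakyHurwitz

theorem mainTheorem6 (k d : ℕ) :
    MvPowerSeries.pderiv ℂ LeakyHurwitz.Var.beta (LeakyHurwitz.genSeries (k : ℤ) d) =
      LeakyHurwitz.cutJoin k d (LeakyHurwitz.genSeries (k : ℤ) d) := by
  open LeakyHurwitz in
  ext e
  obtain ⟨s, M, N, rfl⟩ := exists_vexp_eq e
  rw [MvPowerSeries.coeff_pderiv, vexp_add_beta, vexp_beta, coeff_genSeries]
  by_cases hN : N = 0
  · rw [if_pos hN, zero_mul, hN, coeff_cutJoin_zero]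
  · have h1 : (multFact M : ℂ) ≠ 0 := by exact_mod_cast (multFact_pos M).ne'
    -- On w_s the left side becomes (s+1) ⟨0|α_M w_{s+1}⟩, which is the β-derivative coefficient up
    -- to the weight of M.
    have h2 := vacAlpha_calE k d M (stateVec k d s N)
    rw [calE_stateVec, map_smul, smul_eq_mul] at h2
    rw [if_neg hN, coeff_cutJoin k d s M hN, mul_assoc, mul_assoc, mul_comm (vacAlpha M _), h2,
      mul_left_comm, inv_mul_cancel_left₀ h1, Finset.mul_sum]
    refine Finset.sum_congr rfl fun x _ => ?_
    ring
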